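/- Let $D\ge 2$ be an integer and let $p>1$ be a real number. For an open, bounded, convex, non-empty set $\Omega\subset\mathbb{R}^D$ let $u_p\in W_0^{1,p}(\Omega)$ be the unique weak solution of $-\operatorname{div}(|\nabla u|^{p-2}\nabla u)=1$ in $\Omega$, $u=0$ on $\partial\Omega$; put $T_p(\Omega):=\int_\Omega u_p\,dx$ and $$T(p;\Omega):=|\Omega|^{p-1}\,T_p(\Omega)^{1-p},$$ where $|\Omega|$ is the Lebesgue measure of $\Omega$. Let $$\delta(\Omega):=\frac1{|\Omega|}\int_\Omega \operatorname{dist}(x,\partial\Omega)\,dx,$$ and for $r>0$ let $\mathcal{P}^D[r]$ be the family of all open, bounded, convex sets $\Omega\subset\mathbb{R}^D$ with $\delta(\Omega)=r$. Then there exists a constant $\overline\gamma_{D,p}\in\left[\frac{2}{D(D+1)},1\right)$, depending only on $D$ and $p$, such that for all real numbers $0<a<b$ the following hold. (i) One has $$T(p;\Omega_b)\le T(p;\Omega_a)\qquad\text{for all }\Omega_a\in\mathcal{P}^D[a]\text{ and all }\Omega_b\in\mathcal{P}^D[b]$$ if and only if $\overline\gamma_{D,p}\,b\ge a$. (ii)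 If $\overline\gamma_{D,p}\,b>a$, then $T(p;\Omega_b)<T(p;\Omega_a)$ for all $\Omega_a\in\mathcal{P}^D[a]$ and all $\Omega_b\in\mathcal{P}^D[b]$. (iii) If $\overline\gamma_{D,p}\,b=a$, then equality holds asymptotically: there exist sequences $(\omega_n)_n\subset\mathcal{P}^D[a]$ and $(\Omega_n)_n\subset\mathcal{P}^D[b]$ such that $T(p;\Omega_n)$ and $T(p;\omega_n)$ converge, as $n\to\infty$, to the same finite limit. -/

import Mathlib

open MeasureTheory Filter Topology
open scoped ContDiff

noncomputable section

namespace Torsion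

/-- The `D`-dimensional Euclidean space. -/
abbrev E (D : ℕ) : Type := EuclideanSpace ℝ (Fin D)

/-- `φ ∈ C_c^∞(Ω)`: smooth, with compact support contained in `Ω`. -/
structure IsTestFunction {D : ℕ} (Ω : Set (E D)) (φ : E D → ℝ) : Prop where
  smooth : ContDiff ℝ ∞ φ
  compact : HasCompactSupport φ
  support : tsupport φ ⊆ Ω

/-- `G` is a weak (distributional) gradient of `u` on `Ω`. -/
def IsWeakGradient {D : ℕ} (Ω : Set (E D)) (u : E D → ℝ) (G : E D → E D) : Prop :=
  ∀ φ : E D → ℝ, IsTestFunction Ω φ →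
    ∫ x in Ω, u x • gradient φ x = -∫ x in Ω, φ x • G x

/-- `u ∈ W^{1,p}(Ω)`, with weak gradient `G`. -/
structure MemW1p {D : ℕ} (p : ℝ) (Ω : Set (E D)) (u : E D → ℝ) (G : E D → E D) : Prop where
  memLp : MemLp u (ENNReal.ofReal p) (volume.restrict Ω)
  memLp_grad : MemLp G (ENNReal.ofReal p) (volume.restrict Ω)
  weakGrad : IsWeakGradient Ω u G

/-- `u ∈ W_0^{1,p}(Ω)`, with weak gradient `G`: `u` lies in `W^{1,p}(Ω)` and is a limit, in the
norm of `W^{1,p}(Ω)`, of functions from `C_c^∞(Ω)`. -/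
structure MemW01p {D : ℕ} (p : ℝ) (Ω : Set (E D)) (u : E D → ℝ) (G : E D → E D) : Prop
    extends MemW1p p Ω u G where
  approx : ∃ φ : ℕ → E D → ℝ, (∀ n, IsTestFunction Ω (φ n)) ∧
    Tendsto (fun n => eLpNorm (fun x => φ n x - u x) (ENNReal.ofReal p) (volume.restrict Ω))
      atTop (𝓝 0) ∧
    Tendsto (fun n => eLpNorm (fun x => gradient (φ n) x - G x) (ENNReal.ofReal p)
      (volume.restrict Ω)) atTop (𝓝 0)

/-- `u` is a `p`-torsion function of `Ω`: a weak solution `u ∈ W_0^{1,p}(Ω)` of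
`-div (|∇u|^{p-2} ∇u) = 1` in `Ω`, `u = 0` on `∂Ω`. (Where `∇u = 0` the integrand on the left
is `0`, whatever the value of the power.) -/
def IsTorsionFunction {D : ℕ} (p : ℝ) (Ω : Set (E D)) (u : E D → ℝ) : Prop :=
  ∃ G : E D → E D, MemW01p p Ω u G ∧
    ∀ (v : E D → ℝ) (H : E D → E D), MemW01p p Ω v H →
      ∫ x in Ω, ‖G x‖ ^ (p - 2) * inner ℝ (G x) (H x) = ∫ x in Ω, v x

open Classical in
/-- The `p`-torsional rigidity `T_p(Ω) = ∫_Ω u_p`, with `u_p` the `p`-torsion function of `Ω`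
(which exists and is unique almost everywhere when `Ω` is bounded and open and `p > 1`). -/
def torsionalRigidity {D : ℕ} (p : ℝ) (Ω : Set (E D)) : ℝ :=
  if h : ∃ u : E D → ℝ, IsTorsionFunction p Ω u then ∫ x in Ω, h.choose x else 0

/-- The normalized `p`-torsional rigidity `T(p;Ω) = |Ω|^{p-1} T_p(Ω)^{1-p}`. -/
def normTorsion {D : ℕ} (p : ℝ) (Ω : Set (E D)) : ℝ :=
  (volume.real Ω) ^ (p - 1) * (torsionalRigidity p Ω) ^ (1 - p)

/-- The average over `Ω` of the distance to the boundary of `Ω`. -/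
def avgDist {D : ℕ} (Ω : Set (E D)) : ℝ :=
  (1 / volume.real Ω) * ∫ x in Ω, Metric.infDist x (frontier Ω)

/-- The open, bounded, convex sets in `ℝ^D` whose average distance to the boundary is `r`
(for `r > 0` such sets are non-empty). -/
def convexDomains (D : ℕ) (r : ℝ) : Set (Set (E D)) :=
  {Ω | IsOpen Ω ∧ Bornology.IsBounded Ω ∧ Convex ℝ Ω ∧ avgDist Ω = r}

end Torsion

end

/-! ### The L¹ inequality on convex sets. -/

namespace Torsion

/-! Let `q` be conjugate to `p` and let `C` be the least constant with `|∫ φ| ≤ C ‖∇φ‖_p` for test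
functions. Testing the torsion equation with its own solution and using Hölder gives `C =
T_p(Ω)^{1/q}`, hence `T(p;Ω) = |Ω|^{p-1} / C^p`. The quotient `F(Ω) = δ(Ω) |Ω|^{1/q} / C` is
dilation invariant and `T(p;Ω) = (F(Ω) / δ(Ω))^p`. By dilation every shape occurs in every family,
so the whole comparison is governed by `m = inf F` and `M = sup F`, and the threshold is `m / M`.
Sequences approaching `m` and `M` give the asymptotic equality.

It remains to place `m / M` in the stated interval.

Lower end: `F ≥ 1/(D+1)` and `F ≤ 1`, while `D ≥ 2`. The first bound joins `C ≤ R |Ω|^{1/q}`, with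
`R` the inradius (`lintegral_enorm_le_of_halfspaces` and Hölder), to `R ≤ (D+1) δ(Ω)`, which follows
from concavity of the distance function (`IsConvexDomain.infDist_le_avgDist`). The second uses the
distance function itself as a trial function (`IsConvexDomain.shapeRatio_le_one`).

Upper end: strictness `m < M` comes from two explicit families. Long boxes approach a slab and give
`m ≤ (1/2)(q+1)^{1/q}` (`le_of_forall_le_shapeRatio_box`). The unit ball, through the divergence
theorem for the field `x`, gives `M ≥ D/(D+1) ((D+q)/D)^{1/q}` (`le_shapeRatio_ball`). Bernoulli's
inequality separates the two numbers (`slab_lt_ball`).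

Since the rigidity is defined through a chosen torsion function, existence has to be proved as well.
A minimizing sequence is made Cauchy by a quantitative uniform convexity inequality and Poincaré's
inequality (`IsConvexDomain.exists_minimizer`), and its limit, rescaled, solves the equation. -/

theorem norm_gradient_eq {D : ℕ} (f : E D → ℝ) (x : E D) : ‖gradient f x‖ = ‖fderiv ℝ f x‖ := by
  simp [gradient]

/-- A `C¹` function vanishing at `x + r • n`, `‖n‖ = 1`, is bounded at `x` by the integral of its
derivative along the segment. -/
theorem enorm_le_lintegral_fderiv_of_eq_zero {D : ℕ} {v : E D → ℝ} (hv : ContDiff ℝ 1 v)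
    {n x : E D} (hn : ‖n‖ = 1) {r : ℝ} (hr : 0 ≤ r) (h0 : v (x + r • n) = 0) :
    ‖v x‖ₑ ≤ ∫⁻ s in Set.Ioc 0 r, ‖fderiv ℝ v (x + s • n)‖ₑ := by
  have hd : ∀ s : ℝ, HasDerivAt (fun s : ℝ => v (x + s • n)) (fderiv ℝ v (x + s • n) n) s := by
    intro s
    have h1 : HasDerivAt (fun s : ℝ => x + s • n) n s := by
      simpa using ((hasDerivAt_id s).smul_const n).const_add x
    exact ((hv.differentiable one_ne_zero) _).hasFDerivAt.comp_hasDerivAt s h1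
  have hc : Continuous fun s : ℝ => fderiv ℝ v (x + s • n) n := by
    have := hv.continuous_fderiv one_ne_zero
    fun_prop
  have hi := intervalIntegral.integral_eq_sub_of_hasDerivAt (a := 0) (b := r)
    (fun s _ => hd s) (hc.intervalIntegrable 0 r)
  simp only [h0, zero_smul, add_zero, zero_sub] at hi
  have : ‖v x‖ₑ = ‖∫ s in Set.Ioc 0 r, fderiv ℝ v (x + s • n) n‖ₑ := by
    rw [← intervalIntegral.integral_of_le hr, hi, enorm_neg]
  rw [this]
  refine (enorm_integral_le_lintegral_enorm _).trans (lintegral_mono fun s => ?_)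
  calc ‖fderiv ℝ v (x + s • n) n‖ₑ ≤ ‖fderiv ℝ v (x + s • n)‖ₑ * ‖n‖ₑ :=
        (fderiv ℝ v (x + s • n)).le_opENorm n
    _ = _ := by
        have : ‖n‖ₑ = 1 := by rw [← ofReal_norm, hn, ENNReal.ofReal_one]
        rw [this, mul_one]

/-- Cut space into cells according to which half-space wall is nearest. Moving along `n i` lowers `l
i` at unit rate and every other `l j` at most at unit rate, so a point of cell `i` stays in that
cell and meets its wall, where `v = 0`, after a length of at most `K`. Integrating along these
segments and using Fubini costs a factor `K` per cell, and the cells are disjoint, so the factors do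
not add up. -/
theorem lintegral_enorm_le_of_halfspaces {D : ℕ} {ι : Type*} [Fintype ι] [LinearOrder ι]
    (n : ι → E D) (c : ι → ℝ) (hn : ∀ i, ‖n i‖ = 1) {v : E D → ℝ} (hv : ContDiff ℝ 1 v)
    (h0 : ∀ x i, c i ≤ inner ℝ (n i) x → v x = 0) {K : ℝ}
    (hK : ∀ x, v x ≠ 0 → ∃ i, c i - inner ℝ (n i) x ≤ K) :
    ∫⁻ x, ‖v x‖ₑ ≤ ENNReal.ofReal K * ∫⁻ x, ‖fderiv ℝ v x‖ₑ := by
  set l : ι → E D → ℝ := fun i x => c i - inner ℝ (n i) x with hl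
  have hlc : ∀ i, Continuous (l i) := fun i => by fun_prop
  -- Ties are given to the smallest index, which makes the cells disjoint; this is the only use of
  -- the order on `ι`.
  set S : ι → Set (E D) := fun i => {x | (∀ j < i, l i x < l j x) ∧ ∀ j, l i x ≤ l j x} with hS
  have hSm : ∀ i, MeasurableSet (S i) := by
    intro i
    have h1 : S i = (⋂ j, ⋂ (_ : j < i), {x | l i x < l j x}) ∩ ⋂ j, {x | l i x ≤ l j x} := by
      ext x; simp [hS]
    rw [h1]
    refine MeasurableSet.inter ?_ ?_
    · exact .iInter fun j => .iInter fun _ =>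
        measurableSet_lt (hlc i).measurable (hlc j).measurable
    · exact .iInter fun j => measurableSet_le (hlc i).measurable (hlc j).measurable
  have hSd : Pairwise (Function.onFun Disjoint S) := by
    intro i j hij
    rw [Function.onFun, Set.disjoint_left]
    rintro x ⟨hi1, hi2⟩ ⟨hj1, hj2⟩
    rcases lt_or_gt_of_ne hij with h | h
    · exact absurd (hj1 i h) (not_lt.2 (hi2 j))
    · exact absurd (hi1 j h) (not_lt.2 (hj2 i))
  have hcover : ∀ x, v x ≠ 0 → x ∈ ⋃ i, S i := by
    intro x hx
    obtain ⟨i0, -⟩ := hK x hx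
    obtain ⟨i1, -, hi1⟩ := Finset.exists_min_image Finset.univ (fun i => l i x) ⟨i0, Finset.mem_univ _⟩
    have hne : (Finset.univ.filter fun i => ∀ j, l i x ≤ l j x).Nonempty :=
      ⟨i1, by simpa using hi1⟩
    obtain ⟨i, hi, hmin⟩ := Finset.exists_min_image _ id hne
    simp only [Finset.mem_filter, Finset.mem_univ, true_and] at hi hmin
    refine Set.mem_iUnion.2 ⟨i, fun j hj => lt_of_not_ge fun hle => ?_, hi⟩
    exact absurd (hmin j fun k => hle.trans (hi k)) (not_le.2 hj)
  have hshift : ∀ i j x (s : ℝ), 0 ≤ s → l i x - s ≤ l j (x + s • n i) - (l j x - l i x) := by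
    intro i j x s hs
    have : inner ℝ (n j) (n i) ≤ 1 := by
      have := real_inner_le_norm (n j) (n i)
      rwa [hn, hn, one_mul] at this
    simp only [hl, inner_add_right, inner_smul_right]
    nlinarith
  have hshift' : ∀ i x (s : ℝ), l i (x + s • n i) = l i x - s := by
    intro i x s
    simp only [hl, inner_add_right, inner_smul_right, real_inner_self_eq_norm_sq, hn]
    ring
  have hmem : ∀ i x (s : ℝ), 0 ≤ s → x ∈ S i → x + s • n i ∈ S i := by
    rintro i x s hs ⟨h1, h2⟩
    refine ⟨fun j hj => ?_, fun j => ?_⟩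
    · have := hshift i j x s hs
      have := h1 j hj
      rw [hshift']; linarith
    · have := hshift i j x s hs
      have := h2 j
      rw [hshift']; linarith
  have hmv : Measurable fun x => ‖fderiv ℝ v x‖ₑ :=
    (hv.continuous_fderiv one_ne_zero).enorm.measurable
  have hcell : ∀ i, ∫⁻ x in S i, ‖v x‖ₑ ≤ ENNReal.ofReal K * ∫⁻ x in S i, ‖fderiv ℝ v x‖ₑ := by
    intro i
    -- The indicator records that the segments never leave the cell. The `x`-integral can then be
    -- enlarged to all of space, where it is translation invariant.
    set F : E D → ENNReal := (S i).indicator fun x => ‖fderiv ℝ v x‖ₑ with hF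
    have hFm : Measurable F := hmv.indicator (hSm i)
    have hpt : ∀ x ∈ S i, ‖v x‖ₑ ≤ ∫⁻ s in Set.Ioc 0 K, F (x + s • n i) := by
      intro x hx
      by_cases hvx : v x = 0
      · simp [hvx]
      have hpos : 0 ≤ l i x := by
        by_contra! h
        exact hvx (h0 x i (by simp only [hl] at h; linarith))
      have hle : l i x ≤ K := by
        obtain ⟨j, hj⟩ := hK x hvx
        exact (hx.2 j).trans hj
      have hz : v (x + l i x • n i) = 0 := by
        apply h0 _ i
        have := hshift' i x (l i x)
        simp only [hl] at this ⊢
        linarith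
      calc ‖v x‖ₑ ≤ ∫⁻ s in Set.Ioc 0 (l i x), ‖fderiv ℝ v (x + s • n i)‖ₑ :=
            enorm_le_lintegral_fderiv_of_eq_zero hv (hn i) hpos hz
        _ = ∫⁻ s in Set.Ioc 0 (l i x), F (x + s • n i) := by
            refine setLIntegral_congr_fun measurableSet_Ioc fun s hs => ?_
            simp only [hF]
            rw [Set.indicator_of_mem (hmem i x s hs.1.le hx)]
        _ ≤ _ := lintegral_mono_set (Set.Ioc_subset_Ioc_right hle)
    calc ∫⁻ x in S i, ‖v x‖ₑ ≤ ∫⁻ x in S i, ∫⁻ s in Set.Ioc 0 K, F (x + s • n i) :=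
          setLIntegral_mono' (hSm i) hpt
      _ ≤ ∫⁻ x, ∫⁻ s in Set.Ioc 0 K, F (x + s • n i) := setLIntegral_le_lintegral _ _
      _ = ∫⁻ s in Set.Ioc 0 K, ∫⁻ x, F (x + s • n i) := by
          refine lintegral_lintegral_swap ?_
          exact (hFm.comp (by fun_prop)).aemeasurable
      _ = ∫⁻ s in Set.Ioc 0 K, ∫⁻ x, F x := by
          refine lintegral_congr fun s => ?_
          exact lintegral_add_right_eq_self F (s • n i)
      _ = _ := by
          rw [lintegral_const, Measure.restrict_apply_univ, Real.volume_Ioc, sub_zero, mul_comm,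
            hF, lintegral_indicator (hSm i)]
  calc ∫⁻ x, ‖v x‖ₑ = ∫⁻ x in ⋃ i, S i, ‖v x‖ₑ := by
        refine (setLIntegral_eq_of_support_subset ?_).symm
        intro x hx
        exact hcover x (by simpa using hx)
    _ = ∑ i, ∫⁻ x in S i, ‖v x‖ₑ := by
        rw [lintegral_iUnion hSm hSd, tsum_fintype]
    _ ≤ ∑ i, ENNReal.ofReal K * ∫⁻ x in S i, ‖fderiv ℝ v x‖ₑ :=
        Finset.sum_le_sum fun i _ => hcell i
    _ = ENNReal.ofReal K * ∫⁻ x in ⋃ i, S i, ‖fderiv ℝ v x‖ₑ := by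
        rw [lintegral_iUnion hSm hSd, tsum_fintype, Finset.mul_sum]
    _ ≤ _ := by gcongr; exact Measure.restrict_le_self

theorem frontier_nonempty_of_isBounded {D : ℕ} (hD : D ≠ 0) {Ω : Set (E D)}
    (hb : Bornology.IsBounded Ω) (hne : Ω.Nonempty) : (frontier Ω).Nonempty := by
  have : Nonempty (Fin D) := ⟨⟨0, Nat.pos_of_ne_zero hD⟩⟩
  rw [nonempty_frontier_iff]
  refine ⟨hne, fun h => ?_⟩
  rw [h] at hb
  exact NoncompactSpace.noncompact_univ (X := E D)
    (Metric.isCompact_of_isClosed_isBounded isClosed_univ hb)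

/-- The linear isoperimetric inequality: on a convex set whose inradius is at most `K`, the `L¹` norm of
a function vanishing on the boundary is at most `K` times that of its derivative. -/
theorem lintegral_enorm_le_of_infDist_le {D : ℕ} (hD : D ≠ 0) {Ω : Set (E D)} (ho : IsOpen Ω)
    (hb : Bornology.IsBounded Ω) (hc : Convex ℝ Ω) {K : ℝ}
    (hK : ∀ x ∈ Ω, Metric.infDist x (frontier Ω) ≤ K)
    {v : E D → ℝ} (hv : ContDiff ℝ 1 v) (hcs : HasCompactSupport v) (hs : tsupport v ⊆ Ω) :
    ∫⁻ x, ‖v x‖ₑ ≤ ENNReal.ofReal K * ∫⁻ x, ‖fderiv ℝ v x‖ₑ := by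
  -- The slack `K' > K` turns the distance bound into an open condition, so that compactness of the
  -- support leaves finitely many half-spaces.
  have main : ∀ K' > K, ∫⁻ x, ‖v x‖ₑ ≤ ENNReal.ofReal K' * ∫⁻ x, ‖fderiv ℝ v x‖ₑ := by
    intro K' hK'
    have hex : ∀ x ∈ tsupport v, ∃ nc : E D × ℝ, ‖nc.1‖ = 1 ∧ (∀ z ∈ Ω, inner ℝ nc.1 z < nc.2) ∧
        nc.2 - inner ℝ nc.1 x < K' := by
      intro x hx
      have hxΩ := hs hx
      obtain ⟨y, hy, hxy⟩ := (Metric.infDist_lt_iff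
        (frontier_nonempty_of_isBounded hD hb ⟨x, hxΩ⟩)).1 ((hK x hxΩ).trans_lt hK')
      have hyΩ : y ∉ Ω := fun h => by
        rw [ho.frontier_eq] at hy; exact hy.2 h
      -- The hyperplane supporting `Ω` at a nearly closest boundary point `y` is no farther from `x`
      -- than `y` is.
      obtain ⟨f, hf⟩ := geometric_hahn_banach_open_point hc ho hyΩ
      set m := (InnerProductSpace.toDual ℝ (E D)).symm f with hm
      have hfm : ∀ z, f z = inner ℝ m z := fun z => by
        rw [hm, InnerProductSpace.toDual_symm_apply]
      have hm0 : 0 < ‖m‖ := by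
        rw [norm_pos_iff]
        intro h
        have := hf x hxΩ
        simp [hfm, h] at this
      have hn1 : ‖‖m‖⁻¹ • m‖ = 1 := by
        rw [norm_smul, norm_inv, norm_norm, inv_mul_cancel₀ hm0.ne']
      refine ⟨(‖m‖⁻¹ • m, inner ℝ (‖m‖⁻¹ • m) y), hn1, fun z hz => ?_, ?_⟩
      · simp only [real_inner_smul_left, ← hfm]
        exact mul_lt_mul_of_pos_left (hf z hz) (inv_pos.2 hm0)
      · simp only
        rw [← inner_sub_right]
        calc _ ≤ ‖‖m‖⁻¹ • m‖ * ‖y - x‖ := real_inner_le_norm _ _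
          _ = dist x y := by rw [hn1, one_mul, dist_comm, dist_eq_norm]
          _ < K' := hxy
    choose! nc h1 h2 h3 using hex
    obtain ⟨t, ht, hcov⟩ := hcs.isCompact.elim_nhds_subcover
      (fun x => {z | (nc x).2 - inner ℝ (nc x).1 z < K'}) (fun x hx => by
        refine IsOpen.mem_nhds ?_ (h3 x hx)
        exact isOpen_lt (by fun_prop) continuous_const)
    let e := t.equivFin
    refine lintegral_enorm_le_of_halfspaces (ι := Fin t.card) (fun i => (nc (e.symm i)).1)
      (fun i => (nc (e.symm i)).2) (fun i => h1 _ (ht _ (e.symm i).2)) hv ?_ ?_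
    · intro x i hi
      by_contra hvx
      exact absurd (h2 _ (ht _ (e.symm i).2) x (hs (subset_tsupport _ hvx))) (not_lt.2 hi)
    · intro x hvx
      obtain ⟨z, hz, hxz⟩ := Set.mem_iUnion₂.1 (hcov (subset_tsupport _ hvx))
      refine ⟨e ⟨z, hz⟩, ?_⟩
      simp only [Equiv.symm_apply_apply]
      exact hxz.le
  have hlim : Tendsto (fun K' => ENNReal.ofReal K' * ∫⁻ x, ‖fderiv ℝ v x‖ₑ) (𝓝[>] K)
      (𝓝 (ENNReal.ofReal K * ∫⁻ x, ‖fderiv ℝ v x‖ₑ)) := by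
    refine ENNReal.Tendsto.mul_const ?_ (Or.inr ?_)
    · exact (ENNReal.continuous_ofReal.tendsto K).mono_left nhdsWithin_le_nhds
    · have h1 : Integrable (fderiv ℝ v) :=
        (hv.continuous_fderiv one_ne_zero).integrable_of_hasCompactSupport (hcs.fderiv ℝ)
      exact h1.2.ne
  exact ge_of_tendsto hlim (eventually_mem_nhdsWithin.mono main)

end Torsion

/-! ### Test functions, the torsion constant and Poincaré's inequality. -/

namespace Torsion

variable {D : ℕ} {p : ℝ} {Ω : Set (E D)} {φ ψ : E D → ℝ}

theorem continuous_gradient {f : E D → ℝ} (hf : ContDiff ℝ 1 f) : Continuous (gradient f) :=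
  (InnerProductSpace.toDual ℝ (E D)).symm.continuous.comp (hf.continuous_fderiv one_ne_zero)

theorem inner_gradient (f : E D → ℝ) (x y : E D) :
    inner ℝ (gradient f x) y = fderiv ℝ f x y := by
  rw [gradient, InnerProductSpace.toDual_symm_apply]

theorem IsTestFunction.contDiff_one (h : IsTestFunction Ω φ) : ContDiff ℝ 1 φ :=
  h.smooth.of_le (by exact_mod_cast le_top)

theorem IsTestFunction.continuous (h : IsTestFunction Ω φ) : Continuous φ := h.smooth.continuous

theorem IsTestFunction.differentiable (h : IsTestFunction Ω φ) : Differentiable ℝ φ :=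
  h.contDiff_one.differentiable one_ne_zero

theorem IsTestFunction.continuous_gradient (h : IsTestFunction Ω φ) : Continuous (gradient φ) :=
  Torsion.continuous_gradient h.contDiff_one

theorem IsTestFunction.hasCompactSupport_gradient (h : IsTestFunction Ω φ) :
    HasCompactSupport (gradient φ) :=
  (h.compact.fderiv ℝ).comp_left (g := (InnerProductSpace.toDual ℝ (E D)).symm) (map_zero _)

theorem IsTestFunction.eq_zero (h : IsTestFunction Ω φ) {x : E D} (hx : x ∉ Ω) : φ x = 0 :=
  image_eq_zero_of_notMem_tsupport fun hx' => hx (h.support hx')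

theorem IsTestFunction.gradient_eq_zero (h : IsTestFunction Ω φ) {x : E D} (hx : x ∉ Ω) :
    gradient φ x = 0 := by
  have : fderiv ℝ φ x = 0 := by
    by_contra hne
    exact hx (h.support (support_fderiv_subset ℝ hne))
  simp [gradient, this]

theorem IsTestFunction.memLp (h : IsTestFunction Ω φ) (r : ENNReal) :
    MemLp φ r (volume.restrict Ω) :=
  (h.continuous.memLp_of_hasCompactSupport h.compact).restrict Ω

theorem IsTestFunction.memLp_gradient (h : IsTestFunction Ω φ) (r : ENNReal) :
    MemLp (gradient φ) r (volume.restrict Ω) :=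
  (h.continuous_gradient.memLp_of_hasCompactSupport h.hasCompactSupport_gradient).restrict Ω

theorem IsTestFunction.gradient_add (h : IsTestFunction Ω φ) (h' : IsTestFunction Ω ψ) (x : E D) :
    gradient (fun y => φ y + ψ y) x = gradient φ x + gradient ψ x := by
  simp only [gradient]
  rw [fderiv_fun_add (h.differentiable x) (h'.differentiable x), map_add]

theorem IsTestFunction.gradient_const_mul (h : IsTestFunction Ω φ) (c : ℝ) (x : E D) :
    gradient (fun y => c * φ y) x = c • gradient φ x := by
  simp only [gradient]
  rw [fderiv_const_mul (h.differentiable x), map_smul]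

theorem IsTestFunction.add (h : IsTestFunction Ω φ) (h' : IsTestFunction Ω ψ) :
    IsTestFunction Ω fun x => φ x + ψ x where
  smooth := h.smooth.add h'.smooth
  compact := h.compact.add h'.compact
  support := (tsupport_add φ ψ).trans (Set.union_subset h.support h'.support)

theorem IsTestFunction.const_mul (h : IsTestFunction Ω φ) (c : ℝ) :
    IsTestFunction Ω fun x => c * φ x where
  smooth := contDiff_const.mul h.smooth
  compact := h.compact.mul_left
  support := (closure_mono (Function.support_const_smul_subset c φ)).trans h.support

theorem IsTestFunction.isWeakGradient (h : IsTestFunction Ω φ) :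
    IsWeakGradient Ω φ (gradient φ) := by
  intro ψ hψ
  rw [setIntegral_eq_integral_of_forall_compl_eq_zero (s := Ω)
    (fun x hx => by rw [h.eq_zero hx, zero_smul]),
    setIntegral_eq_integral_of_forall_compl_eq_zero (s := Ω)
    (fun x hx => by rw [hψ.eq_zero hx, zero_smul])]
  have i1 : Integrable fun x => φ x • gradient ψ x :=
    (h.continuous.smul hψ.continuous_gradient).integrable_of_hasCompactSupport h.compact.smul_right
  have i2 : Integrable fun x => ψ x • gradient φ x :=
    (hψ.continuous.smul h.continuous_gradient).integrable_of_hasCompactSupport hψ.compact.smul_right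
  refine ext_inner_left ℝ fun w => ?_
  rw [inner_neg_right, ← integral_inner i1, ← integral_inner i2]
  have e1 : ∀ x, inner ℝ w (φ x • gradient ψ x) = φ x * fderiv ℝ ψ x w := fun x => by
    rw [inner_smul_right, real_inner_comm, inner_gradient]
  have e2 : ∀ x, inner ℝ w (ψ x • gradient φ x) = fderiv ℝ φ x w * ψ x := fun x => by
    rw [inner_smul_right, real_inner_comm, inner_gradient, mul_comm]
  simp only [e1, e2]
  have c1 : Continuous fun x => fderiv ℝ ψ x w := by
    have := hψ.contDiff_one.continuous_fderiv one_ne_zero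
    fun_prop
  have c2 : Continuous fun x => fderiv ℝ φ x w := by
    have := h.contDiff_one.continuous_fderiv one_ne_zero
    fun_prop
  refine integral_mul_fderiv_eq_neg_fderiv_mul_of_integrable ?_ ?_ ?_ (fun x _ => h.differentiable x)
    (fun x _ => hψ.differentiable x)
  · exact (c2.mul hψ.continuous).integrable_of_hasCompactSupport hψ.compact.mul_left
  · exact (h.continuous.mul c1).integrable_of_hasCompactSupport h.compact.mul_right
  · exact (h.continuous.mul hψ.continuous).integrable_of_hasCompactSupport h.compact.mul_right

theorem IsTestFunction.memW01p (h : IsTestFunction Ω φ) : MemW01p p Ω φ (gradient φ) where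
  memLp := h.memLp _
  memLp_grad := h.memLp_gradient _
  weakGrad := h.isWeakGradient
  approx := ⟨fun _ => φ, fun _ => h, by simp, by simp⟩

/-- The `L^p` norm of a vector field on `Ω`. -/
noncomputable def energyNorm (p : ℝ) (Ω : Set (E D)) (G : E D → E D) : ℝ :=
  (∫ x in Ω, ‖G x‖ ^ p) ^ (1 / p)

theorem energyNorm_nonneg (G : E D → E D) : 0 ≤ energyNorm p Ω G :=
  Real.rpow_nonneg (integral_nonneg fun _ => Real.rpow_nonneg (norm_nonneg _) _) _

theorem energyNorm_rpow (hp : 1 < p) (G : E D → E D) :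
    energyNorm p Ω G ^ p = ∫ x in Ω, ‖G x‖ ^ p := by
  rw [energyNorm, ← Real.rpow_mul, one_div_mul_cancel (by positivity), Real.rpow_one]
  exact integral_nonneg fun _ => Real.rpow_nonneg (norm_nonneg _) _

theorem eLpNorm_eq_ofReal_energyNorm (hp : 1 < p) {G : E D → E D}
    (hG : MemLp G (ENNReal.ofReal p) (volume.restrict Ω)) :
    eLpNorm G (ENNReal.ofReal p) (volume.restrict Ω) = ENNReal.ofReal (energyNorm p Ω G) := by
  have hp0 : 0 < p := by positivity
  rw [hG.eLpNorm_eq_integral_rpow_norm (by simpa using hp0) ENNReal.ofReal_ne_top,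
    ENNReal.toReal_ofReal hp0.le, energyNorm, one_div]

theorem energyNorm_eq_toReal (hp : 1 < p) {G : E D → E D}
    (hG : MemLp G (ENNReal.ofReal p) (volume.restrict Ω)) :
    energyNorm p Ω G = (eLpNorm G (ENNReal.ofReal p) (volume.restrict Ω)).toReal := by
  rw [eLpNorm_eq_ofReal_energyNorm hp hG, ENNReal.toReal_ofReal (energyNorm_nonneg G)]

/-- `C` bounds the functional `φ ↦ ∫ φ` with respect to the `W₀^{1,p}` energy. -/
def IsTorsionBound (p : ℝ) (Ω : Set (E D)) (C : ℝ) : Prop :=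
  0 ≤ C ∧ ∀ φ : E D → ℝ, IsTestFunction Ω φ → |∫ x in Ω, φ x| ≤ C * energyNorm p Ω (gradient φ)

/-- The least constant `C` with `|∫ φ| ≤ C ‖∇φ‖_p` for all test functions. -/
noncomputable def torsionConst (p : ℝ) (Ω : Set (E D)) : ℝ := sInf {C | IsTorsionBound p Ω C}

theorem torsionConst_le {C : ℝ} (h : IsTorsionBound p Ω C) : torsionConst p Ω ≤ C :=
  csInf_le ⟨0, fun _ h => h.1⟩ h

/-- The infimum is attained: for positive energy divide by it, and for zero energy any bound already
forces the integral to vanish. -/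
theorem IsTorsionBound.torsionConst {C : ℝ} (h : IsTorsionBound p Ω C) :
    IsTorsionBound p Ω (torsionConst p Ω) := by
  refine ⟨le_csInf ⟨C, h⟩ fun _ h => h.1, fun φ hφ => ?_⟩
  rcases (energyNorm_nonneg (p := p) (Ω := Ω) (gradient φ)).eq_or_lt with h0 | h0
  · have := h.2 φ hφ
    rw [← h0, mul_zero] at this ⊢
    exact this
  · rw [← div_le_iff₀ h0]
    exact le_csInf ⟨C, h⟩ fun c hc => (div_le_iff₀ h0).2 (hc.2 φ hφ)

theorem integral_abs_le_of_infDist_le (hD : D ≠ 0) (ho : IsOpen Ω)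
    (hb : Bornology.IsBounded Ω) (hc : Convex ℝ Ω) {K : ℝ} (hK0 : 0 ≤ K)
    (hK : ∀ x ∈ Ω, Metric.infDist x (frontier Ω) ≤ K)
    {v : E D → ℝ} (hv : ContDiff ℝ 1 v) (hcs : HasCompactSupport v) (hs : tsupport v ⊆ Ω) :
    ∫ x in Ω, |v x| ≤ K * ∫ x in Ω, ‖gradient v x‖ := by
  have h := lintegral_enorm_le_of_infDist_le hD ho hb hc hK hv hcs hs
  have i1 : Integrable v := hv.continuous.integrable_of_hasCompactSupport hcs
  have i2 : Integrable (fderiv ℝ v) :=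
    (hv.continuous_fderiv one_ne_zero).integrable_of_hasCompactSupport (hcs.fderiv ℝ)
  rw [setIntegral_eq_integral_of_forall_compl_eq_zero (s := Ω) (fun x hx => by
      rw [image_eq_zero_of_notMem_tsupport fun hx' => hx (hs hx'), abs_zero]),
    setIntegral_eq_integral_of_forall_compl_eq_zero (s := Ω) (fun x hx => by
      rw [norm_gradient_eq, norm_eq_zero]
      by_contra hne
      exact hx (hs (support_fderiv_subset ℝ hne)))]
  simp only [norm_gradient_eq, ← Real.norm_eq_abs]
  rw [integral_norm_eq_lintegral_enorm i1.1, integral_norm_eq_lintegral_enorm i2.1]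
  have h3 := ENNReal.toReal_mono (ENNReal.mul_ne_top ENNReal.ofReal_ne_top i2.2.ne) h
  rwa [ENNReal.toReal_mul, ENNReal.toReal_ofReal hK0] at h3

theorem integral_mul_le_energyNorm {q : ℝ} (hpq : p.HolderConjugate q) {w : E D → ℝ}
    (hw0 : ∀ x, 0 ≤ w x) (hw : MemLp w (ENNReal.ofReal q) (volume.restrict Ω)) {G : E D → E D}
    (hG : MemLp G (ENNReal.ofReal p) (volume.restrict Ω)) :
    ∫ x in Ω, w x * ‖G x‖ ≤ (∫ x in Ω, w x ^ q) ^ (1 / q) * energyNorm p Ω G :=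
  integral_mul_le_Lp_mul_Lq_of_nonneg hpq.symm (ae_of_all _ hw0)
    (ae_of_all _ fun _ => norm_nonneg _) hw hG.norm

/-- The L¹ inequality followed by Hölder against the constant function `1`. With `K` comparable to
the average distance this gives the lower bound on the shape ratio. -/
theorem isTorsionBound_of_infDist_le (hD : D ≠ 0) {q : ℝ} (hpq : p.HolderConjugate q)
    (ho : IsOpen Ω) (hb : Bornology.IsBounded Ω) (hc : Convex ℝ Ω) {K : ℝ} (hK0 : 0 ≤ K)
    (hK : ∀ x ∈ Ω, Metric.infDist x (frontier Ω) ≤ K) :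
    IsTorsionBound p Ω (K * volume.real Ω ^ (1 / q)) := by
  refine ⟨by positivity, fun φ hφ => ?_⟩
  have hfin : IsFiniteMeasure (volume.restrict Ω) :=
    ⟨by simpa using hb.measure_lt_top⟩
  have h1 := integral_mul_le_energyNorm (Ω := Ω) hpq (w := fun _ => 1) (fun _ => zero_le_one)
    (memLp_const 1) (hφ.memLp_gradient _)
  simp only [one_mul, Real.one_rpow, integral_const, measureReal_restrict_apply_univ,
    smul_eq_mul, mul_one] at h1
  calc |∫ x in Ω, φ x| ≤ ∫ x in Ω, |φ x| := abs_integral_le_integral_abs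
    _ ≤ K * ∫ x in Ω, ‖gradient φ x‖ :=
        integral_abs_le_of_infDist_le hD ho hb hc hK0 hK hφ.contDiff_one hφ.compact hφ.support
    _ ≤ _ := by rw [mul_assoc]; gcongr

/-- Poincaré's inequality. -/
theorem integral_rpow_le_of_infDist_le (hD : D ≠ 0) (hp : 1 < p)
    (ho : IsOpen Ω) (hb : Bornology.IsBounded Ω) (hc : Convex ℝ Ω) {K : ℝ} (hK0 : 0 ≤ K)
    (hK : ∀ x ∈ Ω, Metric.infDist x (frontier Ω) ≤ K) (hφ : IsTestFunction Ω φ) :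
    (∫ x in Ω, |φ x| ^ p) ^ (1 / p) ≤ K * p * energyNorm p Ω (gradient φ) := by
  have hp0 : 0 < p := by positivity
  obtain ⟨q, hpq⟩ : ∃ q, p.HolderConjugate q := ⟨_, Real.HolderConjugate.conjExponent hp⟩
  -- The L¹ inequality is applied to `|φ|^p`, which is C¹ because `p > 1`. Hölder then produces the
  -- factor `I ^ (1/q)`, which is cancelled at the end.
  set v : E D → ℝ := fun x => ‖φ x‖ ^ p with hv
  have hvc : ContDiff ℝ 1 v := hφ.contDiff_one.norm_rpow hp
  have hsub : Function.support v ⊆ Function.support φ := by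
    intro x hx hx0
    exact hx (by simp [hv, hx0, hp0.ne'])
  have hts : tsupport v ⊆ tsupport φ := closure_mono hsub
  have hvcs : HasCompactSupport v := hφ.compact.mono hsub
  have h1 := integral_abs_le_of_infDist_le hD ho hb hc hK0 hK hvc hvcs (hts.trans hφ.support)
  have h2 : ∫ x in Ω, ‖gradient v x‖ ≤ p * ∫ x in Ω, |φ x| ^ (p - 1) * ‖gradient φ x‖ := by
    rw [← integral_const_mul]
    refine integral_mono_of_nonneg (ae_of_all _ fun _ => norm_nonneg _) ?_
      (ae_of_all _ fun x => ?_)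
    · refine Integrable.const_mul ?_ _
      refine Integrable.restrict (Continuous.integrable_of_hasCompactSupport ?_ ?_)
      · exact ((continuous_abs.comp hφ.continuous).rpow_const fun x => Or.inr (by linarith)).mul
          hφ.continuous_gradient.norm
      · exact hφ.hasCompactSupport_gradient.norm.mul_left
    · simp only [norm_gradient_eq]
      have := norm_fderiv_norm_rpow_le hφ.differentiable (x := x) hp
      rw [← Real.norm_eq_abs, ← mul_assoc]
      exact this
  have hw : MemLp (fun x => |φ x| ^ (p - 1)) (ENNReal.ofReal q) (volume.restrict Ω) := by
    refine (Continuous.memLp_of_hasCompactSupport ?_ ?_).restrict Ω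
    · exact (continuous_abs.comp hφ.continuous).rpow_const fun x => Or.inr (by linarith)
    · refine hφ.compact.comp_left (g := fun t : ℝ => |t| ^ (p - 1)) ?_
      simp [(sub_pos.2 hp).ne']
  have h3 := integral_mul_le_energyNorm hpq (fun x => by positivity) hw
    (hφ.memLp_gradient (ENNReal.ofReal p))
  have h4 : ∀ x, (|φ x| ^ (p - 1)) ^ q = |φ x| ^ p := fun x => by
    rw [← Real.rpow_mul (abs_nonneg _), hpq.sub_one_mul_conj]
  simp only [h4] at h3
  set I := ∫ x in Ω, |φ x| ^ p with hI
  have hI0 : 0 ≤ I := integral_nonneg fun _ => by positivity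
  have h5 : I ≤ K * p * energyNorm p Ω (gradient φ) * I ^ (1 / q) := by
    calc I = ∫ x in Ω, |v x| := by
          rw [hI]; congr 1; ext x
          simp only [hv, Real.norm_eq_abs]
          exact (abs_of_nonneg (by positivity)).symm
      _ ≤ K * ∫ x in Ω, ‖gradient v x‖ := h1
      _ ≤ K * (p * (I ^ (1 / q) * energyNorm p Ω (gradient φ))) := by
          gcongr; exact h2.trans (by gcongr)
      _ = _ := by ring
  rcases hI0.eq_or_lt with h0 | h0
  · rw [← h0, Real.zero_rpow (by positivity)]
    have := energyNorm_nonneg (p := p) (Ω := Ω) (gradient φ)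
    positivity
  · have h6 : I = I ^ (1 / p) * I ^ (1 / q) := by
      rw [← Real.rpow_add h0, one_div, one_div, hpq.inv_add_inv_eq_one, Real.rpow_one]
    have h7 : 0 < I ^ (1 / q) := by positivity
    nth_rewrite 1 [h6] at h5
    exact le_of_mul_le_mul_right h5 h7

end Torsion

/-! ### Uniform convexity of the `p`-th power of the norm. -/

namespace Torsion

section VectorInequality

variable {F : Type*} [NormedAddCommGroup F] [InnerProductSpace ℝ F]

/-- For equal norms the triangle inequality is strict, since distinct vectors of equal length are
not on one ray; for different norms `t ↦ t ^ p` is strictly convex. -/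
theorem norm_midpoint_rpow_lt {p : ℝ} (hp : 1 < p) {x y : F} (hxy : x ≠ y) :
    ‖(1 / 2 : ℝ) • (x + y)‖ ^ p < (‖x‖ ^ p + ‖y‖ ^ p) / 2 := by
  have hp0 : 0 < p := by positivity
  have e : ‖(1 / 2 : ℝ) • (x + y)‖ = ‖x + y‖ / 2 := by
    rw [norm_smul]; norm_num; ring
  rw [e]
  by_cases hn : ‖x‖ = ‖y‖
  · have h1 : ‖x + y‖ < ‖x‖ + ‖y‖ := by
      refine lt_of_le_of_ne (norm_add_le x y) fun h => hxy ?_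
      have := sameRay_iff_norm_add.2 h
      exact (sameRay_iff_of_norm_eq hn).1 this
    calc (‖x + y‖ / 2) ^ p < ‖x‖ ^ p := by
          apply Real.rpow_lt_rpow (by positivity) _ hp0
          linarith
      _ = _ := by rw [← hn]; ring
  · have h2 := (strictConvexOn_rpow hp).2 (norm_nonneg x) (norm_nonneg y) hn
      (by norm_num : (0 : ℝ) < 1 / 2) (by norm_num : (0 : ℝ) < 1 / 2) (by norm_num)
    simp only [smul_eq_mul] at h2
    calc (‖x + y‖ / 2) ^ p ≤ (1 / 2 * ‖x‖ + 1 / 2 * ‖y‖) ^ p := by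
          apply Real.rpow_le_rpow (by positivity) _ hp0.le
          have := norm_add_le x y
          linarith
      _ < _ := h2
      _ = _ := by ring

/-- A quantitative form of the uniform convexity of `x ↦ ‖x‖ ^ p`. -/
theorem exists_norm_sub_rpow_le [FiniteDimensional ℝ F] {p : ℝ} (hp : 1 < p) {ε : ℝ} (hε : 0 < ε) :
    ∃ C : ℝ, 0 ≤ C ∧ ∀ x y : F, ‖x - y‖ ^ p ≤ ε * (‖x‖ ^ p + ‖y‖ ^ p) +
      C * ((‖x‖ ^ p + ‖y‖ ^ p) / 2 - ‖(1 / 2 : ℝ) • (x + y)‖ ^ p) := by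
  have hp0 : 0 < p := by positivity
  have hcont : ∀ f : F × F → F, Continuous f → Continuous fun z => ‖f z‖ ^ p := fun f hf =>
    hf.norm.rpow_const fun _ => Or.inr hp0.le
  set Ψ : F × F → ℝ := fun z => (‖z.1‖ ^ p + ‖z.2‖ ^ p) / 2 - ‖(1 / 2 : ℝ) • (z.1 + z.2)‖ ^ p with hΨ
  have hΨc : Continuous Ψ :=
    (((hcont _ continuous_fst).add (hcont _ continuous_snd)).div_const 2).sub
      (hcont _ (by fun_prop))
  have hΨ0 : ∀ x y : F, 0 ≤ Ψ (x, y) := by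
    intro x y
    by_cases hxy : x = y
    · subst hxy
      have : (1 / 2 : ℝ) • (x + x) = x := by rw [← two_smul ℝ x, smul_smul]; norm_num
      simp only [hΨ, this]
      linarith
    · exact sub_nonneg.2 (norm_midpoint_rpow_lt hp hxy).le
  have hle1 : ∀ x y : F, ‖x‖ ^ p + ‖y‖ ^ p = 1 → ‖x‖ ≤ 1 ∧ ‖y‖ ≤ 1 := by
    intro x y h
    have hx : 0 ≤ ‖x‖ ^ p := by positivity
    have hy : 0 ≤ ‖y‖ ^ p := by positivity
    constructor
    · by_contra! h1
      have := Real.one_lt_rpow h1 hp0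
      linarith
    · by_contra! h1
      have := Real.one_lt_rpow h1 hp0
      linarith
  -- By homogeneity it suffices to treat `‖x‖^p + ‖y‖^p = 1`. There, the pairs with `‖x - y‖^p ≥ ε`
  -- form a compact set on which the convexity deficit `Ψ` has a positive lower bound `m`.
  set S : Set (F × F) := {z | ‖z.1‖ ^ p + ‖z.2‖ ^ p = 1 ∧ ε ≤ ‖z.1 - z.2‖ ^ p} with hS
  have hSc : IsCompact S := by
    refine Metric.isCompact_of_isClosed_isBounded ?_ ?_
    · exact (isClosed_eq ((hcont _ continuous_fst).add (hcont _ continuous_snd))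
        continuous_const).inter (isClosed_le continuous_const (hcont _ (by fun_prop)))
    · refine (Metric.isBounded_closedBall (x := (0 : F × F)) (r := 1)).subset fun z hz => ?_
      have := hle1 _ _ hz.1
      rw [mem_closedBall_zero_iff, Prod.norm_def]
      exact max_le this.1 this.2
  obtain ⟨m, hm0, hm⟩ : ∃ m > 0, ∀ z ∈ S, m ≤ Ψ z := by
    rcases S.eq_empty_or_nonempty with he | hne
    · exact ⟨1, one_pos, by simp [he]⟩
    · obtain ⟨z, hz, hmin⟩ := hSc.exists_isMinOn hne hΨc.continuousOn
      refine ⟨Ψ z, ?_, fun w hw => hmin hw⟩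
      refine sub_pos.2 (norm_midpoint_rpow_lt hp fun h => ?_)
      have := hz.2
      rw [h, sub_self, norm_zero, Real.zero_rpow hp0.ne'] at this
      linarith
  -- On `S` the left side is at most `2 ^ p` and `Ψ ≥ m`; off `S` the `ε` term alone suffices.
  refine ⟨2 ^ p / m, by positivity, ?_⟩
  have hunit : ∀ x y : F, ‖x‖ ^ p + ‖y‖ ^ p = 1 → ‖x - y‖ ^ p ≤ ε + 2 ^ p / m * Ψ (x, y) := by
    intro x y h
    by_cases hz : ε ≤ ‖x - y‖ ^ p
    · have h1 : ‖x - y‖ ^ p ≤ 2 ^ p := by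
        apply Real.rpow_le_rpow (norm_nonneg _) _ hp0.le
        have := norm_sub_le x y
        have := hle1 x y h
        linarith
      have h2 := hm (x, y) ⟨h, hz⟩
      have h3 : 2 ^ p ≤ 2 ^ p / m * Ψ (x, y) := by
        rw [div_mul_eq_mul_div, le_div_iff₀ hm0]
        gcongr
      linarith
    · have := hΨ0 x y
      have : 0 ≤ 2 ^ p / m * Ψ (x, y) := by positivity
      linarith
  intro x y
  set s : ℝ := ‖x‖ ^ p + ‖y‖ ^ p with hs
  have hs0 : 0 ≤ s := by positivity
  rcases hs0.eq_or_lt with h0 | h0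
  · have hx : ‖x‖ ^ p = 0 := by
      have : 0 ≤ ‖x‖ ^ p := by positivity
      have : 0 ≤ ‖y‖ ^ p := by positivity
      linarith
    have hy : ‖y‖ ^ p = 0 := by linarith
    rw [Real.rpow_eq_zero (norm_nonneg _) hp0.ne', norm_eq_zero] at hx hy
    simp [hx, hy, hp0.ne', ← h0]
  · set r : ℝ := s ^ (-(1 / p)) with hr
    have hr0 : 0 < r := by positivity
    have hrp : r ^ p = s⁻¹ := by
      rw [hr, ← Real.rpow_mul hs0, neg_mul, one_div_mul_cancel hp0.ne', Real.rpow_neg_one]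
    have hsm : ∀ z : F, ‖r • z‖ ^ p = s⁻¹ * ‖z‖ ^ p := fun z => by
      rw [norm_smul, Real.mul_rpow (norm_nonneg _) (norm_nonneg _), Real.norm_of_nonneg hr0.le, hrp]
    have h1 := hunit (r • x) (r • y) (by
      rw [hsm, hsm, ← mul_add, inv_mul_cancel₀ h0.ne'])
    have e1 : Ψ (r • x, r • y) = s⁻¹ * Ψ (x, y) := by
      simp only [hΨ]
      rw [← smul_add, smul_comm, hsm, hsm, hsm]
      ring
    rw [← smul_sub, hsm, e1] at h1
    have h2 := mul_le_mul_of_nonneg_left h1 hs0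
    rw [← mul_assoc, mul_inv_cancel₀ h0.ne', one_mul] at h2
    refine h2.trans (le_of_eq ?_)
    simp only [hΨ]
    rw [← hs]
    field_simp

end VectorInequality

end Torsion

/-! ### Limits in `W_0^{1,p}` and the Euler–Lagrange equation. -/

namespace Torsion

variable {D : ℕ} {p : ℝ} {Ω : Set (E D)}

theorem tendsto_integral_of_tendsto_eLpNorm {α F ι : Type*} [MeasurableSpace α] {μ : Measure α}
    [IsFiniteMeasure μ] [NormedAddCommGroup F] [NormedSpace ℝ F] {l : Filter ι} {r : ENNReal}
    (hr : 1 ≤ r) {f : ι → α → F} {g : α → F} (hf : ∀ i, MemLp (f i) r μ) (hg : MemLp g r μ)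
    (h : Tendsto (fun i => eLpNorm (fun x => f i x - g x) r μ) l (𝓝 0)) :
    Tendsto (fun i => ∫ x, f i x ∂μ) l (𝓝 (∫ x, g x ∂μ)) := by
  refine tendsto_integral_of_L1' g hg.1
    (Eventually.of_forall fun i => (hf i).integrable hr) ?_
  have hC : μ Set.univ ^ (1 / (1 : ENNReal).toReal - 1 / r.toReal) ≠ ⊤ := by
    refine ENNReal.rpow_ne_top_of_nonneg ?_ (measure_ne_top _ _)
    rw [sub_nonneg, ENNReal.toReal_one, div_one]
    by_cases hr' : r = ⊤
    · simp [hr']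
    · have : 1 ≤ r.toReal := by
        rw [← ENNReal.toReal_one]; exact ENNReal.toReal_mono hr' hr
      exact div_le_one_of_le₀ this (by linarith)
  have h2 := ENNReal.Tendsto.mul_const (b := μ Set.univ ^ (1 / (1 : ENNReal).toReal - 1 / r.toReal))
    h (Or.inr hC)
  rw [zero_mul] at h2
  refine tendsto_of_tendsto_of_tendsto_of_le_of_le tendsto_const_nhds h2 (fun _ => zero_le) fun i => ?_
  exact eLpNorm_le_eLpNorm_mul_rpow_measure_univ hr ((hf i).sub hg).1

theorem tendsto_eLpNorm_smul_sub {α F ι : Type*} [MeasurableSpace α] {μ : Measure α}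
    [NormedAddCommGroup F] [NormedSpace ℝ F] {l : Filter ι} {r : ENNReal}
    {f : ι → α → F} {g : α → F} {c : α → ℝ} (hc : MemLp c ⊤ μ)
    (hf : ∀ i, MemLp (f i) r μ) (hg : MemLp g r μ)
    (h : Tendsto (fun i => eLpNorm (fun x => f i x - g x) r μ) l (𝓝 0)) :
    Tendsto (fun i => eLpNorm (fun x => c x • f i x - c x • g x) r μ) l (𝓝 0) := by
  have h2 := ENNReal.Tendsto.const_mul (a := eLpNorm c ⊤ μ) h (Or.inr hc.2.ne)
  rw [mul_zero] at h2
  refine tendsto_of_tendsto_of_tendsto_of_le_of_le tendsto_const_nhds h2 (fun _ => zero_le) fun i => ?_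
  simp only [← smul_sub]
  exact eLpNorm_smul_le_mul_eLpNorm ((hf i).sub hg).1 hc.1

theorem tendsto_eLpNorm_sub_smul {α F ι : Type*} [MeasurableSpace α] {μ : Measure α}
    [NormedAddCommGroup F] [NormedSpace ℝ F] {l : Filter ι} {r : ENNReal}
    {f : ι → α → ℝ} {g : α → ℝ} {c : α → F} (hc : MemLp c ⊤ μ)
    (hf : ∀ i, MemLp (f i) r μ) (hg : MemLp g r μ)
    (h : Tendsto (fun i => eLpNorm (fun x => f i x - g x) r μ) l (𝓝 0)) :
    Tendsto (fun i => eLpNorm (fun x => f i x • c x - g x • c x) r μ) l (𝓝 0) := by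
  have h2 := ENNReal.Tendsto.mul_const (b := eLpNorm c ⊤ μ) h (Or.inr hc.2.ne)
  rw [zero_mul] at h2
  refine tendsto_of_tendsto_of_tendsto_of_le_of_le tendsto_const_nhds h2 (fun _ => zero_le) fun i => ?_
  simp only [← sub_smul]
  exact eLpNorm_smul_le_mul_eLpNorm hc.1 ((hf i).sub hg).1

theorem isFiniteMeasure_restrict (hb : Bornology.IsBounded Ω) :
    IsFiniteMeasure (volume.restrict Ω) :=
  ⟨by simpa using hb.measure_lt_top⟩

theorem one_le_ofReal (hp : 1 < p) : 1 ≤ ENNReal.ofReal p := by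
  rw [← ENNReal.ofReal_one]; exact ENNReal.ofReal_le_ofReal hp.le

/-- The weak gradient identity need not be assumed of the limit: both sides pass to the limit,
because the test function and its gradient are bounded and convergence in `L^p` on a bounded set
implies convergence of integrals. -/
theorem MemW01p.of_tendsto (hp : 1 < p) (hb : Bornology.IsBounded Ω) {u : E D → ℝ}
    {G : E D → E D} {φ : ℕ → E D → ℝ} (hφ : ∀ n, IsTestFunction Ω (φ n))
    (hu : MemLp u (ENNReal.ofReal p) (volume.restrict Ω))
    (hG : MemLp G (ENNReal.ofReal p) (volume.restrict Ω))
    (h1 : Tendsto (fun n => eLpNorm (fun x => φ n x - u x) (ENNReal.ofReal p) (volume.restrict Ω))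
      atTop (𝓝 0))
    (h2 : Tendsto (fun n => eLpNorm (fun x => gradient (φ n) x - G x) (ENNReal.ofReal p)
      (volume.restrict Ω)) atTop (𝓝 0)) : MemW01p p Ω u G where
  memLp := hu
  memLp_grad := hG
  approx := ⟨φ, hφ, h1, h2⟩
  weakGrad := by
    intro ψ hψ
    have := isFiniteMeasure_restrict hb
    have hr := one_le_ofReal hp
    have c1 := hψ.memLp_gradient ⊤
    have c2 := hψ.memLp ⊤
    have l1 := tendsto_integral_of_tendsto_eLpNorm hr (fun n => c1.smul ((hφ n).memLp (ENNReal.ofReal p)))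
      (c1.smul hu) (tendsto_eLpNorm_sub_smul c1 (fun n => (hφ n).memLp _) hu h1)
    have l2 := tendsto_integral_of_tendsto_eLpNorm hr (fun n => ((hφ n).memLp_gradient (ENNReal.ofReal p)).smul c2)
      (hG.smul c2) (tendsto_eLpNorm_smul_sub c2 (fun n => (hφ n).memLp_gradient _) hG h2)
    refine tendsto_nhds_unique l1 ?_
    convert! l2.neg using 1
    ext1 n
    exact (hφ n).isWeakGradient ψ hψ

theorem MemW01p.add_const_mul (hp : 1 < p) (hb : Bornology.IsBounded Ω) {u v : E D → ℝ}
    {G H : E D → E D} (hu : MemW01p p Ω u G) (hv : MemW01p p Ω v H) (a b : ℝ) :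
    MemW01p p Ω (fun x => a * u x + b * v x) (fun x => a • G x + b • H x) := by
  obtain ⟨φ, hφ, f1, f2⟩ := hu.approx
  obtain ⟨ψ, hψ, g1, g2⟩ := hv.approx
  have hr := one_le_ofReal hp
  have key : ∀ {F : Type} [NormedAddCommGroup F] [NormedSpace ℝ F] {f g : ℕ → E D → F}
      {f' g' : E D → F},
      (∀ n, MemLp (f n) (ENNReal.ofReal p) (volume.restrict Ω)) →
      (∀ n, MemLp (g n) (ENNReal.ofReal p) (volume.restrict Ω)) →
      MemLp f' (ENNReal.ofReal p) (volume.restrict Ω) →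
      MemLp g' (ENNReal.ofReal p) (volume.restrict Ω) →
      Tendsto (fun n => eLpNorm (fun x => f n x - f' x) (ENNReal.ofReal p) (volume.restrict Ω))
        atTop (𝓝 0) →
      Tendsto (fun n => eLpNorm (fun x => g n x - g' x) (ENNReal.ofReal p) (volume.restrict Ω))
        atTop (𝓝 0) →
      Tendsto (fun n => eLpNorm (fun x => (a • f n x + b • g n x) - (a • f' x + b • g' x))
        (ENNReal.ofReal p) (volume.restrict Ω)) atTop (𝓝 0) := by
    intro F _ _ f g f' g' mf mg mf' mg' hf hg
    have t := (ENNReal.Tendsto.const_mul (a := ‖a‖ₑ) hf (Or.inr enorm_ne_top)).add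
      (ENNReal.Tendsto.const_mul (a := ‖b‖ₑ) hg (Or.inr enorm_ne_top))
    simp only [mul_zero, add_zero] at t
    refine tendsto_of_tendsto_of_tendsto_of_le_of_le tendsto_const_nhds t (fun _ => zero_le)
      fun n => ?_
    have e : (fun x => (a • f n x + b • g n x) - (a • f' x + b • g' x)) =
        (a • fun x => f n x - f' x) + (b • fun x => g n x - g' x) := by
      ext x
      simp only [Pi.add_apply, Pi.smul_apply, smul_sub]
      abel
    rw [e]
    refine (eLpNorm_add_le (((mf n).sub mf').const_smul a).1
      (((mg n).sub mg').const_smul b).1 hr).trans ?_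
    rw [eLpNorm_const_smul, eLpNorm_const_smul]
    exact le_rfl
  refine MemW01p.of_tendsto hp hb (φ := fun n x => a * φ n x + b * ψ n x)
    (fun n => ((hφ n).const_mul a).add ((hψ n).const_mul b)) ?_ ?_ ?_ ?_
  · exact (hu.memLp.const_mul a).add (hv.memLp.const_mul b)
  · exact (hu.memLp_grad.const_smul a).add (hv.memLp_grad.const_smul b)
  · exact key (fun n => (hφ n).memLp _) (fun n => (hψ n).memLp _) hu.memLp hv.memLp f1 g1
  · have := key (fun n => (hφ n).memLp_gradient _) (fun n => (hψ n).memLp_gradient _)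
      hu.memLp_grad hv.memLp_grad f2 g2
    refine this.congr fun n => ?_
    congr 1
    ext1 x
    rw [IsTestFunction.gradient_add ((hφ n).const_mul a) ((hψ n).const_mul b),
      (hφ n).gradient_const_mul, (hψ n).gradient_const_mul]

/-- A bound known on test functions extends by density to the closure. -/
theorem MemW01p.abs_integral_le (hp : 1 < p) (hb : Bornology.IsBounded Ω) {u : E D → ℝ}
    {G : E D → E D} (hu : MemW01p p Ω u G) {C : ℝ} (hC : IsTorsionBound p Ω C) :
    |∫ x in Ω, u x| ≤ C * energyNorm p Ω G := by
  have := isFiniteMeasure_restrict hb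
  have hr := one_le_ofReal hp
  obtain ⟨φ, hφ, f1, f2⟩ := hu.approx
  have l1 := (tendsto_integral_of_tendsto_eLpNorm hr (fun n => (hφ n).memLp _) hu.memLp f1).enorm
  have l2 : Tendsto (fun n => ENNReal.ofReal C * (eLpNorm (fun x => gradient (φ n) x - G x)
      (ENNReal.ofReal p) (volume.restrict Ω) + eLpNorm G (ENNReal.ofReal p) (volume.restrict Ω)))
      atTop (𝓝 (ENNReal.ofReal C * (0 + eLpNorm G (ENNReal.ofReal p) (volume.restrict Ω)))) :=
    ENNReal.Tendsto.const_mul (f2.add tendsto_const_nhds) (Or.inr ENNReal.ofReal_ne_top)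
  rw [zero_add, eLpNorm_eq_ofReal_energyNorm hp hu.memLp_grad, ← ENNReal.ofReal_mul hC.1] at l2
  have h := le_of_tendsto_of_tendsto' l1 l2 fun n => by
    calc ‖∫ x in Ω, φ n x‖ₑ = ENNReal.ofReal |∫ x in Ω, φ n x| := by
          rw [← Real.norm_eq_abs, ofReal_norm]
      _ ≤ ENNReal.ofReal (C * energyNorm p Ω (gradient (φ n))) :=
          ENNReal.ofReal_le_ofReal (hC.2 _ (hφ n))
      _ = ENNReal.ofReal C * eLpNorm (gradient (φ n)) (ENNReal.ofReal p) (volume.restrict Ω) := by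
          rw [ENNReal.ofReal_mul hC.1, eLpNorm_eq_ofReal_energyNorm hp ((hφ n).memLp_gradient _)]
      _ ≤ _ := by
          rw [← eLpNorm_eq_ofReal_energyNorm hp hu.memLp_grad]
          gcongr
          have := eLpNorm_add_le (((hφ n).memLp_gradient (ENNReal.ofReal p)).sub hu.memLp_grad).1
            hu.memLp_grad.1 hr
          rwa [sub_add_cancel] at this
  rw [← ofReal_norm, Real.norm_eq_abs, ENNReal.ofReal_le_ofReal_iff
    (mul_nonneg hC.1 (energyNorm_nonneg G))] at h
  exact h

/-- The exponents fit because `(p - 1) q = p`. -/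
theorem memLp_norm_rpow_sub_one {q : ℝ} (hpq : p.HolderConjugate q) {G : E D → E D}
    (hG : MemLp G (ENNReal.ofReal p) (volume.restrict Ω)) :
    MemLp (fun x => ‖G x‖ ^ (p - 1)) (ENNReal.ofReal q) (volume.restrict Ω) := by
  have h := hG.norm_rpow_div (ENNReal.ofReal (p - 1))
  rw [ENNReal.toReal_ofReal hpq.sub_one_pos.le, ← ENNReal.ofReal_div_of_pos hpq.sub_one_pos,
    ← hpq.conjugate_eq] at h
  exact h

theorem integral_norm_rpow_mul_le {q : ℝ} (hpq : p.HolderConjugate q) {G H : E D → E D}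
    (hG : MemLp G (ENNReal.ofReal p) (volume.restrict Ω))
    (hH : MemLp H (ENNReal.ofReal p) (volume.restrict Ω)) :
    ∫ x in Ω, ‖G x‖ ^ (p - 1) * ‖H x‖ ≤ (∫ x in Ω, ‖G x‖ ^ p) ^ (1 / q) * energyNorm p Ω H := by
  have h := integral_mul_le_energyNorm hpq (fun x => by positivity)
    (memLp_norm_rpow_sub_one hpq hG) hH
  refine h.trans (le_of_eq ?_)
  congr 3
  ext x
  rw [← Real.rpow_mul (norm_nonneg _), hpq.sub_one_mul_conj]

theorem integrable_norm_rpow_mul {q : ℝ} (hpq : p.HolderConjugate q) {G H : E D → E D}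
    (hG : MemLp G (ENNReal.ofReal p) (volume.restrict Ω))
    (hH : MemLp H (ENNReal.ofReal p) (volume.restrict Ω)) :
    Integrable (fun x => ‖G x‖ ^ (p - 1) * ‖H x‖) (volume.restrict Ω) := by
  have := hpq.symm.ennrealOfReal
  exact (memLp_norm_rpow_sub_one hpq hG).integrable_mul hH.norm

theorem norm_rpow_mul_inner_le {F : Type*} [NormedAddCommGroup F] [InnerProductSpace ℝ F]
    (hp : 1 < p) (x y : F) :
    |‖x‖ ^ (p - 2) * inner ℝ x y| ≤ ‖x‖ ^ (p - 1) * ‖y‖ := by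
  rw [abs_mul, abs_of_nonneg (by positivity)]
  rcases eq_or_ne x 0 with rfl | hx
  · simp [(sub_pos.2 hp).ne']
  · have hx0 : 0 < ‖x‖ := norm_pos_iff.2 hx
    calc _ ≤ ‖x‖ ^ (p - 2) * (‖x‖ * ‖y‖) := by
          gcongr; exact abs_real_inner_le_norm x y
      _ = _ := by
          rw [← mul_assoc, ← Real.rpow_add_one hx0.ne']
          ring_nf

theorem integrable_norm_rpow_mul_inner {q : ℝ} (hpq : p.HolderConjugate q) {G H : E D → E D}
    (hG : MemLp G (ENNReal.ofReal p) (volume.restrict Ω))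
    (hH : MemLp H (ENNReal.ofReal p) (volume.restrict Ω)) :
    Integrable (fun x => ‖G x‖ ^ (p - 2) * inner ℝ (G x) (H x)) (volume.restrict Ω) := by
  refine (integrable_norm_rpow_mul hpq hG hH).mono' ?_ (ae_of_all _ fun x => ?_)
  · exact (hG.1.norm.aemeasurable.pow_const _).aestronglyMeasurable.mul (hG.1.inner hH.1)
  · exact norm_rpow_mul_inner_le hpq.lt _ _

/-- The Euler–Lagrange equation of the `p`-energy. -/
theorem integral_norm_rpow_mul_inner_eq_zero {q : ℝ} (hpq : p.HolderConjugate q)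
    {G H : E D → E D} (hG : MemLp G (ENNReal.ofReal p) (volume.restrict Ω))
    (hH : MemLp H (ENNReal.ofReal p) (volume.restrict Ω))
    (hmin : ∀ t : ℝ, ∫ x in Ω, ‖G x‖ ^ p ≤ ∫ x in Ω, ‖G x + t • H x‖ ^ p) :
    ∫ x in Ω, ‖G x‖ ^ (p - 2) * inner ℝ (G x) (H x) = 0 := by
  have hp := hpq.lt
  have hp0 := hpq.pos
  have hm : ∀ t : ℝ, MemLp (fun x => G x + t • H x) (ENNReal.ofReal p) (volume.restrict Ω) :=
    fun t => hG.add (hH.const_smul t)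
  -- A majorant, up to the factor `p`, of the `t`-derivative of `‖G + t H‖^p` for `|t| < 1`; it is
  -- integrable by Hölder.
  set B : E D → ℝ := fun x => ‖(‖G x‖ + ‖H x‖)‖ ^ (p - 1) * ‖H x‖ with hB
  have hBi : Integrable B (volume.restrict Ω) := by
    have := hpq.symm.ennrealOfReal
    have h := (hG.norm.add hH.norm).norm_rpow_div (ENNReal.ofReal (p - 1))
    rw [ENNReal.toReal_ofReal hpq.sub_one_pos.le, ← ENNReal.ofReal_div_of_pos hpq.sub_one_pos,
      ← hpq.conjugate_eq] at h
    exact h.integrable_mul hH.norm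
  have hder := hasDerivAt_integral_of_dominated_loc_of_deriv_le (μ := volume.restrict Ω)
    (F := fun (t : ℝ) x => ‖G x + t • H x‖ ^ p) (x₀ := 0) (s := Metric.ball 0 1)
    (bound := fun x => p * B x)
    (F' := fun (t : ℝ) x => p * (‖G x + t • H x‖ ^ (p - 2) * inner ℝ (G x + t • H x) (H x)))
    (Metric.ball_mem_nhds 0 one_pos) ?_ ?_ ?_ ?_ (hBi.const_mul p) ?_
  · have hz := IsLocalMin.hasDerivAt_eq_zero (a := (0 : ℝ)) (Eventually.of_forall fun t => by
      simpa using hmin t) hder.2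
    simp only [zero_smul, add_zero] at hz
    rw [integral_const_mul] at hz
    exact (mul_eq_zero.1 hz).resolve_left hp0.ne'
  · exact Eventually.of_forall fun t =>
      ((hm t).1.norm.aemeasurable.pow_const _).aestronglyMeasurable
  · have := (hm 0).integrable_norm_rpow (by simpa using hp0) ENNReal.ofReal_ne_top
    rwa [ENNReal.toReal_ofReal hp0.le] at this
  · exact ((integrable_norm_rpow_mul_inner hpq (hm 0) hH).const_mul p).1
  · refine ae_of_all _ fun x t ht => ?_
    rw [norm_mul, Real.norm_of_nonneg hp0.le]
    refine mul_le_mul_of_nonneg_left ?_ hp0.le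
    refine (norm_rpow_mul_inner_le hp _ _).trans ?_
    simp only [hB]
    gcongr
    rw [Real.norm_of_nonneg (by positivity)]
    refine (norm_add_le _ _).trans ?_
    gcongr
    rw [norm_smul]
    have : ‖t‖ ≤ 1 := by
      rw [mem_ball_zero_iff] at ht; exact ht.le
    nlinarith [norm_nonneg (H x)]
  · refine ae_of_all _ fun x t _ => ?_
    have h1 : HasDerivAt (fun t : ℝ => G x + t • H x) (H x) t := by
      simpa using ((hasDerivAt_id t).smul_const (H x)).const_add (G x)
    have h2 := (hasFDerivAt_norm_rpow (G x + t • H x) hp).comp_hasDerivAt t h1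
    convert! h2 using 1
    rw [smul_apply, innerSL_apply_apply, smul_eq_mul, mul_assoc]

end Torsion

/-! ### Existence of the torsion function and its link with the torsion constant. -/

namespace Torsion

variable {D : ℕ} {p : ℝ} {Ω : Set (E D)}

/-- Non-empty, open, bounded, convex sets. -/
structure IsConvexDomain (Ω : Set (E D)) : Prop where
  isOpen : IsOpen Ω
  isBounded : Bornology.IsBounded Ω
  convex : Convex ℝ Ω
  nonempty : Ω.Nonempty

theorem IsConvexDomain.volume_pos (h : IsConvexDomain Ω) : 0 < volume.real Ω :=
  ENNReal.toReal_pos (h.isOpen.measure_pos _ h.nonempty).ne' h.isBounded.measure_lt_top.ne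

/-- The diameter is a crude bound, but only finiteness is needed: it makes the set of torsion bounds
non-empty and supplies a Poincaré constant. -/
theorem IsConvexDomain.exists_infDist_le (h : IsConvexDomain Ω) :
    ∃ K, 0 ≤ K ∧ ∀ x ∈ Ω, Metric.infDist x (frontier Ω) ≤ K := by
  refine ⟨Metric.diam (closure Ω), Metric.diam_nonneg, fun x hx => ?_⟩
  rcases (frontier Ω).eq_empty_or_nonempty with he | ⟨y, hy⟩
  · rw [he, Metric.infDist_empty]; exact Metric.diam_nonneg
  · exact (Metric.infDist_le_dist_of_mem hy).trans (Metric.dist_le_diam_of_mem h.isBounded.closure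
      (subset_closure hx) (frontier_subset_closure hy))

theorem IsConvexDomain.isTorsionBound (h : IsConvexDomain Ω) (hD : D ≠ 0) (hp : 1 < p) :
    IsTorsionBound p Ω (torsionConst p Ω) := by
  obtain ⟨K, hK0, hK⟩ := h.exists_infDist_le
  exact (isTorsionBound_of_infDist_le hD (Real.HolderConjugate.conjExponent hp) h.isOpen
    h.isBounded h.convex hK0 hK).torsionConst

theorem IsConvexDomain.exists_isTestFunction (h : IsConvexDomain Ω) :
    ∃ φ, IsTestFunction Ω φ ∧ 0 < ∫ x in Ω, φ x := by
  obtain ⟨x, hx⟩ := h.nonempty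
  obtain ⟨r, hr, hsub⟩ := Metric.nhds_basis_closedBall.mem_iff.1 (h.isOpen.mem_nhds hx)
  let f : ContDiffBump x := ⟨r / 2, r, by positivity, by linarith⟩
  have hf : IsTestFunction Ω f := ⟨f.contDiff, f.hasCompactSupport, by rwa [f.tsupport_eq]⟩
  refine ⟨f, hf, ?_⟩
  rw [setIntegral_eq_integral_of_forall_compl_eq_zero fun x hx => hf.eq_zero hx]
  exact f.integral_pos

theorem IsConvexDomain.torsionConst_pos (h : IsConvexDomain Ω) (hD : D ≠ 0) (hp : 1 < p) :
    0 < torsionConst p Ω := by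
  obtain ⟨φ, hφ, hpos⟩ := h.exists_isTestFunction
  have hb := h.isTorsionBound hD hp
  refine lt_of_le_of_ne hb.1 fun h0 => ?_
  have := hb.2 φ hφ
  rw [← h0, zero_mul] at this
  exact absurd (le_abs_self _) (not_le.2 (this.trans_lt hpos))

/-- Since `c` is not a torsion bound, some test function violates it; dividing by its integral
normalizes it. -/
theorem exists_isTestFunction_energyNorm_lt (hp : 1 < p) {c : ℝ} (hc : 0 < c) (hcC : c < torsionConst p Ω) :
    ∃ φ, IsTestFunction Ω φ ∧ ∫ x in Ω, φ x = 1 ∧ energyNorm p Ω (gradient φ) ≤ c⁻¹ := by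
  have hnot : ¬ IsTorsionBound p Ω c := fun h => absurd (torsionConst_le h) (not_le.2 hcC)
  simp only [IsTorsionBound, hc.le, true_and, not_forall, not_le] at hnot
  obtain ⟨φ, hφ, h⟩ := hnot
  set I := ∫ x in Ω, φ x with hI
  have hN := energyNorm_nonneg (p := p) (Ω := Ω) (gradient φ)
  have hI0 : 0 < |I| := lt_of_le_of_lt (by positivity) h
  have hI0' : I ≠ 0 := abs_pos.1 hI0
  refine ⟨_, hφ.const_mul I⁻¹, ?_, ?_⟩
  · rw [integral_const_mul, ← hI, inv_mul_cancel₀ hI0']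
  · have e : energyNorm p Ω (gradient fun x => I⁻¹ * φ x) =
        ((|I|⁻¹) ^ p * ∫ x in Ω, ‖gradient φ x‖ ^ p) ^ (1 / p) := by
      rw [energyNorm, ← integral_const_mul]
      congr 2
      ext x
      rw [hφ.gradient_const_mul, norm_smul, Real.mul_rpow (norm_nonneg _) (norm_nonneg _), norm_inv,
        Real.norm_eq_abs]
    have hp0 : p ≠ 0 := by positivity
    rw [e, Real.mul_rpow (by positivity) (integral_nonneg fun _ => by positivity),
      ← Real.rpow_mul (by positivity), mul_one_div_cancel hp0, Real.rpow_one]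
    change |I|⁻¹ * energyNorm p Ω (gradient φ) ≤ c⁻¹
    rw [inv_mul_le_iff₀ hI0, ← div_eq_mul_inv, le_div_iff₀ hc]
    linarith

theorem dist_toLp_gradient (hp : 1 < p) [Fact (1 ≤ ENNReal.ofReal p)] {φ ψ : E D → ℝ}
    (hφ : IsTestFunction Ω φ) (hψ : IsTestFunction Ω ψ) :
    dist ((hφ.memLp_gradient (ENNReal.ofReal p)).toLp (gradient φ))
      ((hψ.memLp_gradient (ENNReal.ofReal p)).toLp (gradient ψ)) =
      energyNorm p Ω (fun x => gradient φ x - gradient ψ x) := by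
  rw [dist_edist, Lp.edist_toLp_toLp]
  exact (energyNorm_eq_toReal hp ((hφ.memLp_gradient _).sub (hψ.memLp_gradient _))).symm

/-- Direct method for the least energy under `∫ u = 1`, whose value is `1 / C`. Midpoints of a
minimizing sequence satisfy the constraint too, so the convexity deficit of two late terms is small
and uniform convexity makes the gradients Cauchy in `L^p`. Poincaré does the same for the functions,
so no weak compactness is involved. -/
theorem IsConvexDomain.exists_minimizer (h : IsConvexDomain Ω) (hD : D ≠ 0) (hp : 1 < p) :
    ∃ u G, MemW01p p Ω u G ∧ ∫ x in Ω, u x = 1 ∧ torsionConst p Ω * energyNorm p Ω G = 1 := by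
  have hp0 : 0 < p := by positivity
  have := isFiniteMeasure_restrict h.isBounded
  have hr := one_le_ofReal hp
  have : Fact (1 ≤ ENNReal.ofReal p) := ⟨hr⟩
  set C := torsionConst p Ω with hC
  have hC0 : 0 < C := h.torsionConst_pos hD hp
  have hCb : IsTorsionBound p Ω C := h.isTorsionBound hD hp
  -- The shift by `2` keeps the factor `1 - 1/(n+2)` positive already at `n = 0`.
  have hseq : ∀ n : ℕ, ∃ φ, IsTestFunction Ω φ ∧ ∫ x in Ω, φ x = 1 ∧
      energyNorm p Ω (gradient φ) ≤ (C * (1 - 1 / ((n : ℝ) + 2)))⁻¹ := by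
    intro n
    have h1 : 1 / ((n : ℝ) + 2) < 1 := by
      rw [div_lt_one (by positivity)]; linarith [(Nat.cast_nonneg n : (0 : ℝ) ≤ n)]
    have h2 : 0 < 1 / ((n : ℝ) + 2) := by positivity
    refine exists_isTestFunction_energyNorm_lt hp ?_ ?_
    · exact mul_pos hC0 (by linarith)
    · exact mul_lt_of_lt_one_right hC0 (by linarith)
  choose φ hφ hφ1 hφN using hseq
  set N : ℕ → ℝ := fun n => energyNorm p Ω (gradient (φ n)) with hN
  have hone : ∀ ψ, IsTestFunction Ω ψ → ∫ x in Ω, ψ x = 1 →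
      C⁻¹ ≤ energyNorm p Ω (gradient ψ) := by
    intro ψ hψ h1
    have := hCb.2 ψ hψ
    rw [h1, abs_one] at this
    rwa [inv_le_iff_one_le_mul₀ hC0, mul_comm]
  have hNlim : Tendsto N atTop (𝓝 C⁻¹) := by
    refine tendsto_of_tendsto_of_tendsto_of_le_of_le tendsto_const_nhds (g := fun _ => C⁻¹)
      (h := fun n : ℕ => (C * (1 - 1 / ((n : ℝ) + 2)))⁻¹) ?_ (fun n => hone _ (hφ n) (hφ1 n)) hφN
    have h1 : Tendsto (fun n : ℕ => 1 / ((n : ℝ) + 2)) atTop (𝓝 0) := by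
      refine Tendsto.const_div_atTop ?_ 1
      exact tendsto_atTop_add_const_right _ _ tendsto_natCast_atTop_atTop
    have h2 := (((tendsto_const_nhds (x := (1 : ℝ))).sub h1).const_mul C).inv₀ (by simpa using hC0.ne')
    simpa using h2
  have hNp : Tendsto (fun n => N n ^ p) atTop (𝓝 (C⁻¹ ^ p)) :=
    hNlim.rpow_const (Or.inr hp0.le)
  set L := C⁻¹ ^ p with hL
  have hL0 : 0 ≤ L := by positivity
  set g := fun n => ((hφ n).memLp_gradient (ENNReal.ofReal p)).toLp (gradient (φ n)) with hg
  have hgint : ∀ {G : E D → E D}, MemLp G (ENNReal.ofReal p) (volume.restrict Ω) →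
      Integrable (fun x => ‖G x‖ ^ p) (volume.restrict Ω) := by
    intro G hG
    have := hG.integrable_norm_rpow (by simpa using hp0) ENNReal.ofReal_ne_top
    rwa [ENNReal.toReal_ofReal hp0.le] at this
  have hgc : CauchySeq g := by
    rw [Metric.cauchySeq_iff]
    intro η hη
    -- `ε` and `δ` are chosen so that each of the two terms of the convexity inequality is at most
    -- `η ^ p / 4`; `δ ≤ 1` bounds the sum of the two energies by `2 L + 2`.
    set ε := η ^ p / (4 * (2 * L + 2)) with hε
    have hηp : 0 < η ^ p := by positivity
    obtain ⟨Q, hQ0, hQ⟩ := exists_norm_sub_rpow_le (F := E D) hp (ε := ε) (by positivity)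
    set δ := min 1 (η ^ p / (4 * (Q + 1))) with hδ
    have hδ0 : 0 < δ := lt_min one_pos (by positivity)
    obtain ⟨n0, hn0⟩ := eventually_atTop.1 (hNp.eventually (gt_mem_nhds (by linarith : L < L + δ)))
    refine ⟨n0, fun m hm n hn => ?_⟩
    rw [hg, dist_toLp_gradient hp (hφ m) (hφ n)]
    refine (Real.rpow_lt_rpow_iff (energyNorm_nonneg _) hη.le hp0).1 ?_
    rw [energyNorm_rpow hp]
    have m1 := (hφ m).memLp_gradient (Ω := Ω) (ENNReal.ofReal p)
    have m2 := (hφ n).memLp_gradient (Ω := Ω) (ENNReal.ofReal p)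
    have m3 := (m1.add m2).const_smul (1 / 2 : ℝ)
    have hmid : L ≤ ∫ x in Ω, ‖(1 / 2 : ℝ) • (gradient (φ m) x + gradient (φ n) x)‖ ^ p := by
      have ht := ((hφ m).add (hφ n)).const_mul (1 / 2)
      have h1 := hone _ ht (by
        rw [integral_const_mul, integral_add (((hφ m).memLp _).integrable hr)
          (((hφ n).memLp _).integrable hr), hφ1, hφ1]; norm_num)
      have h2 := Real.rpow_le_rpow (by positivity) h1 hp0.le
      rw [energyNorm_rpow hp] at h2
      refine h2.trans (le_of_eq ?_)
      congr 1
      ext x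
      rw [((hφ m).add (hφ n)).gradient_const_mul, (hφ m).gradient_add (hφ n)]
    have hmono := integral_mono (μ := volume.restrict Ω) (hgint (m1.sub m2))
      ((((hgint m1).add (hgint m2)).const_mul ε).add (((((hgint m1).add (hgint m2)).div_const 2).sub
        (hgint m3)).const_mul Q)) (fun x => hQ (gradient (φ m) x) (gradient (φ n) x))
    have hev : ∫ x in Ω, (ε * (‖gradient (φ m) x‖ ^ p + ‖gradient (φ n) x‖ ^ p) +
        Q * ((‖gradient (φ m) x‖ ^ p + ‖gradient (φ n) x‖ ^ p) / 2 -
          ‖(1 / 2 : ℝ) • (gradient (φ m) x + gradient (φ n) x)‖ ^ p)) =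
        ε * (N m ^ p + N n ^ p) + Q * ((N m ^ p + N n ^ p) / 2 -
          ∫ x in Ω, ‖(1 / 2 : ℝ) • (gradient (φ m) x + gradient (φ n) x)‖ ^ p) := by
      have i1 : Integrable (fun x => ‖gradient (φ m) x‖ ^ p + ‖gradient (φ n) x‖ ^ p)
        (volume.restrict Ω) := (hgint m1).add (hgint m2)
      have i3 : Integrable (fun x => ‖(1 / 2 : ℝ) • (gradient (φ m) x + gradient (φ n) x)‖ ^ p)
        (volume.restrict Ω) := hgint m3
      have i4 : Integrable (fun x => (‖gradient (φ m) x‖ ^ p + ‖gradient (φ n) x‖ ^ p) / 2 -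
          ‖(1 / 2 : ℝ) • (gradient (φ m) x + gradient (φ n) x)‖ ^ p) (volume.restrict Ω) :=
        (i1.div_const 2).sub i3
      rw [integral_add (i1.const_mul ε) (i4.const_mul Q),
        integral_const_mul, integral_const_mul, integral_sub (i1.div_const 2) i3,
        integral_div, integral_add (hgint m1) (hgint m2)]
      simp only [hN, energyNorm_rpow hp]
    have hfin : ∫ x in Ω, ‖gradient (φ m) x - gradient (φ n) x‖ ^ p ≤
        ε * (N m ^ p + N n ^ p) + Q * ((N m ^ p + N n ^ p) / 2 -
          ∫ x in Ω, ‖(1 / 2 : ℝ) • (gradient (φ m) x + gradient (φ n) x)‖ ^ p) :=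
      hmono.trans_eq hev
    have b1 := hn0 m hm
    have b2 := hn0 n hn
    have hε0 : 0 < ε := by positivity
    have d1 : δ ≤ 1 := min_le_left _ _
    have d2 : δ ≤ η ^ p / (4 * (Q + 1)) := min_le_right _ _
    have c1 : ε * (N m ^ p + N n ^ p) ≤ η ^ p / 4 := by
      calc ε * (N m ^ p + N n ^ p) ≤ ε * (2 * L + 2) :=
          mul_le_mul_of_nonneg_left (by linarith) hε0.le
        _ = η ^ p / 4 := by rw [hε]; field_simp
    have c2 : Q * ((N m ^ p + N n ^ p) / 2 -
          ∫ x in Ω, ‖(1 / 2 : ℝ) • (gradient (φ m) x + gradient (φ n) x)‖ ^ p) ≤ η ^ p / 4 := by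
      calc _ ≤ Q * δ := mul_le_mul_of_nonneg_left (by linarith) hQ0
        _ ≤ (Q + 1) * (η ^ p / (4 * (Q + 1))) := by gcongr; linarith
        _ = η ^ p / 4 := by field_simp
    linarith
  obtain ⟨K, hK0, hK⟩ := h.exists_infDist_le
  set w := fun n => ((hφ n).memLp (Ω := Ω) (ENNReal.ofReal p)).toLp (φ n) with hw
  have hwdist : ∀ m n, dist (w m) (w n) ≤ K * p * dist (g m) (g n) := by
    intro m n
    have ht : IsTestFunction Ω fun x => φ m x + (-1) * φ n x := (hφ m).add ((hφ n).const_mul (-1))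
    have h1 := integral_rpow_le_of_infDist_le hD hp h.isOpen h.isBounded h.convex hK0 hK ht
    have e1 : dist (w m) (w n) = (∫ x in Ω, |φ m x + (-1) * φ n x| ^ p) ^ (1 / p) := by
      rw [hw, dist_edist, Lp.edist_toLp_toLp]
      have hm := ((hφ m).memLp (Ω := Ω) (ENNReal.ofReal p)).sub ((hφ n).memLp (ENNReal.ofReal p))
      rw [hm.eLpNorm_eq_integral_rpow_norm (by simpa using hp0) ENNReal.ofReal_ne_top,
        ENNReal.toReal_ofReal hp0.le, ENNReal.toReal_ofReal (by positivity), one_div]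
      congr 2
      ext x
      rw [Pi.sub_apply, Real.norm_eq_abs, neg_one_mul, sub_eq_add_neg]
    have e2 : dist (g m) (g n) = energyNorm p Ω (gradient fun x => φ m x + (-1) * φ n x) := by
      rw [hg, dist_toLp_gradient hp (hφ m) (hφ n)]
      congr 1
      ext1 x
      rw [(hφ m).gradient_add ((hφ n).const_mul (-1)), (hφ n).gradient_const_mul, neg_one_smul,
        sub_eq_add_neg]
    rw [e1, e2]
    exact h1
  have hwc : CauchySeq w := by
    rw [cauchySeq_iff_tendsto_dist_atTop_0] at hgc ⊢
    have := hgc.const_mul (K * p)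
    rw [mul_zero] at this
    exact squeeze_zero (fun _ => dist_nonneg) (fun n => hwdist n.1 n.2) this
  obtain ⟨G, hG⟩ := cauchySeq_tendsto_of_complete hgc
  obtain ⟨u, hu⟩ := cauchySeq_tendsto_of_complete hwc
  have hGlp := Lp.memLp G
  have hulp := Lp.memLp u
  have t1 : Tendsto (fun n => eLpNorm (fun x => gradient (φ n) x - G x) (ENNReal.ofReal p)
      (volume.restrict Ω)) atTop (𝓝 0) := by
    rw [← Lp.toLp_coeFn G hGlp] at hG
    exact (Lp.tendsto_Lp_iff_tendsto_eLpNorm'' _ _ _ hGlp).1 hG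
  have t2 : Tendsto (fun n => eLpNorm (fun x => φ n x - u x) (ENNReal.ofReal p)
      (volume.restrict Ω)) atTop (𝓝 0) := by
    rw [← Lp.toLp_coeFn u hulp] at hu
    exact (Lp.tendsto_Lp_iff_tendsto_eLpNorm'' _ _ _ hulp).1 hu
  have hmem : MemW01p p Ω u G := MemW01p.of_tendsto hp h.isBounded hφ hulp hGlp t2 t1
  have hint : ∫ x in Ω, u x = 1 := by
    have := tendsto_integral_of_tendsto_eLpNorm hr (fun n => (hφ n).memLp _) hulp t2
    simp only [hφ1] at this
    exact tendsto_nhds_unique this tendsto_const_nhds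
  refine ⟨u, G, hmem, hint, ?_⟩
  have hnorm : energyNorm p Ω G = C⁻¹ := by
    have h1 : Tendsto (fun n => ‖g n‖) atTop (𝓝 ‖G‖) := hG.norm
    have h2 : ∀ n, ‖g n‖ = N n := fun n => by
      rw [hg, Lp.norm_toLp, hN]
      exact (energyNorm_eq_toReal hp ((hφ n).memLp_gradient _)).symm
    simp only [h2] at h1
    rw [energyNorm_eq_toReal hp hGlp, ← Lp.norm_def]
    exact tendsto_nhds_unique h1 hNlim
  rw [hnorm, mul_inv_cancel₀ hC0.ne']

theorem norm_rpow_sub_two_mul_inner_self (hp : 1 < p) {F : Type*} [NormedAddCommGroup F]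
    [InnerProductSpace ℝ F] (x : F) : ‖x‖ ^ (p - 2) * inner ℝ x x = ‖x‖ ^ p := by
  rcases eq_or_ne x 0 with rfl | hx
  · simp [(by positivity : p ≠ 0)]
  · have hx0 : 0 < ‖x‖ := norm_pos_iff.2 hx
    rw [real_inner_self_eq_norm_sq, ← Real.rpow_natCast, ← Real.rpow_add hx0]
    norm_num

/-- The minimizer solves the equation up to the Lagrange multiplier `l`, its energy. The operator is
homogeneous of degree `p - 1`, so a multiple of the minimizer has right side `1`. -/
theorem IsConvexDomain.exists_isTorsionFunction (h : IsConvexDomain Ω) (hD : D ≠ 0) (hp : 1 < p) :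
    ∃ u, IsTorsionFunction p Ω u := by
  have hp0 : 0 < p := by positivity
  obtain ⟨q, hpq⟩ : ∃ q, p.HolderConjugate q := ⟨_, Real.HolderConjugate.conjExponent hp⟩
  obtain ⟨u, G, hu, hu1, hG⟩ := h.exists_minimizer hD hp
  have hCb := h.isTorsionBound hD hp
  have hC0 := h.torsionConst_pos hD hp
  set C := torsionConst p Ω
  have hr := one_le_ofReal hp
  have := isFiniteMeasure_restrict h.isBounded
  have hN : energyNorm p Ω G = C⁻¹ := (inv_eq_of_mul_eq_one_right hG).symm
  set l := ∫ x in Ω, ‖G x‖ ^ p with hl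
  have hlC : l = C⁻¹ ^ p := by rw [hl, ← energyNorm_rpow hp, hN]
  have hl0 : 0 < l := by rw [hlC]; positivity
  have key : ∀ v H, MemW01p p Ω v H →
      ∫ x in Ω, ‖G x‖ ^ (p - 2) * inner ℝ (G x) (H x) = l * ∫ x in Ω, v x := by
    intro v H hv
    set k := ∫ x in Ω, v x with hk
    -- The direction `v - k u` has zero integral, so the whole line through `u` satisfies the
    -- constraint and `u` minimizes the energy on it.
    have hz := integral_norm_rpow_mul_inner_eq_zero hpq hu.memLp_grad
      (H := fun x => (1 : ℝ) • H x + (-k) • G x)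
      ((hv.memLp_grad.const_smul (1 : ℝ)).add (hu.memLp_grad.const_smul (-k))) (fun t => by
        have hw := hu.add_const_mul hp h.isBounded (hv.add_const_mul hp h.isBounded hu 1 (-k)) 1 t
        have h1 := hw.abs_integral_le hp h.isBounded hCb
        have iu := hu.memLp.integrable hr
        have iv := hv.memLp.integrable hr
        have iw : Integrable (fun x => 1 * v x + -k * u x) (volume.restrict Ω) :=
          (iv.const_mul 1).add (iu.const_mul (-k))
        rw [integral_add (iu.const_mul 1) (iw.const_mul t),
          integral_const_mul, integral_const_mul, integral_add (iv.const_mul 1)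
          (iu.const_mul (-k)), integral_const_mul, integral_const_mul, hu1, ← hk] at h1
        have h2 : C⁻¹ ≤ energyNorm p Ω fun x => G x + t • ((1 : ℝ) • H x + (-k) • G x) := by
          rw [inv_le_iff_one_le_mul₀ hC0, mul_comm]
          simpa using h1
        have h3 := Real.rpow_le_rpow (by positivity) h2 hp0.le
        rwa [energyNorm_rpow hp, ← hlC] at h3)
    have e : ∀ x, ‖G x‖ ^ (p - 2) * inner ℝ (G x) ((1 : ℝ) • H x + (-k) • G x) =
        ‖G x‖ ^ (p - 2) * inner ℝ (G x) (H x) - k * ‖G x‖ ^ p := by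
      intro x
      rw [inner_add_right, one_smul, inner_smul_right, mul_add, mul_left_comm,
        norm_rpow_sub_two_mul_inner_self hp]
      ring
    simp only [e] at hz
    have i2 : Integrable (fun x => ‖G x‖ ^ p) (volume.restrict Ω) := by
      have := hu.memLp_grad.integrable_norm_rpow (by simpa using hp0) ENNReal.ofReal_ne_top
      rwa [ENNReal.toReal_ofReal hp0.le] at this
    rw [integral_sub (integrable_norm_rpow_mul_inner hpq hu.memLp_grad hv.memLp_grad)
      (i2.const_mul k), integral_const_mul, ← hl] at hz
    linarith
  set c := (l⁻¹) ^ (1 / (p - 1)) with hc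
  have hc0 : 0 < c := by positivity
  have hcp : c ^ (p - 1) = l⁻¹ := by
    rw [hc, ← Real.rpow_mul (by positivity), one_div_mul_cancel hpq.sub_one_pos.ne', Real.rpow_one]
  -- The zero term only matches the two-term shape of the linear combination lemma.
  refine ⟨fun x => c * u x + 0 * u x, fun x => c • G x + (0 : ℝ) • G x,
    hu.add_const_mul hp h.isBounded hu c 0, fun v H hv => ?_⟩
  have e : ∀ x, ‖c • G x + (0 : ℝ) • G x‖ ^ (p - 2) * inner ℝ (c • G x + (0 : ℝ) • G x) (H x) =
      l⁻¹ * (‖G x‖ ^ (p - 2) * inner ℝ (G x) (H x)) := by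
    intro x
    rw [zero_smul, add_zero, norm_smul, Real.norm_of_nonneg hc0.le, Real.mul_rpow hc0.le
      (norm_nonneg _), real_inner_smul_left, ← hcp]
    have : c ^ (p - 1) = c ^ (p - 2) * c := by
      rw [← Real.rpow_add_one hc0.ne']; ring_nf
    rw [this]
    ring
  simp only [e]
  rw [integral_const_mul, key v H hv, inv_mul_cancel_left₀ hl0.ne']

/-- Testing the equation with `u` itself gives `∫ ‖∇u‖^p = ∫ u = T`. Hölder in the equation yields
`C ≤ T^{1/q}`; the torsion bound applied to `u` yields `T ≤ C T^{1/p}`. As `u` is any torsion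
function, the choice made in the definition of the rigidity is harmless. -/
theorem IsConvexDomain.torsionConst_eq (h : IsConvexDomain Ω) (hD : D ≠ 0) {q : ℝ}
    (hpq : p.HolderConjugate q) {u : E D → ℝ} (hu : IsTorsionFunction p Ω u) :
    0 ≤ ∫ x in Ω, u x ∧ torsionConst p Ω = (∫ x in Ω, u x) ^ (1 / q) := by
  have hp := hpq.lt
  obtain ⟨G, hW, hG⟩ := hu
  set T := ∫ x in Ω, u x with hT
  have hGT : ∫ x in Ω, ‖G x‖ ^ p = T := by
    rw [hT, ← hG u G hW]
    congr 1
    ext x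
    rw [norm_rpow_sub_two_mul_inner_self hp]
  have hT0 : 0 ≤ T := by rw [← hGT]; exact integral_nonneg fun _ => by positivity
  refine ⟨hT0, le_antisymm (torsionConst_le ⟨by positivity, fun φ hφ => ?_⟩) ?_⟩
  · rw [← hG φ _ hφ.memW01p]
    refine abs_integral_le_integral_abs.trans ?_
    refine (integral_mono_of_nonneg (ae_of_all _ fun _ => abs_nonneg _)
      (integrable_norm_rpow_mul hpq hW.memLp_grad (hφ.memLp_gradient _))
      (ae_of_all _ fun x => norm_rpow_mul_inner_le hp _ _)).trans ?_
    rw [← hGT]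
    exact integral_norm_rpow_mul_le hpq hW.memLp_grad (hφ.memLp_gradient _)
  · have hC := h.isTorsionBound hD hp
    have h1 := hW.abs_integral_le hp h.isBounded hC
    rw [energyNorm, hGT, ← hT, abs_of_nonneg hT0] at h1
    rcases hT0.eq_or_lt with h0 | h0
    · rw [← h0, Real.zero_rpow (one_div_pos.2 hpq.symm.pos).ne']
      exact hC.1
    · have h6 : T = T ^ (1 / q) * T ^ (1 / p) := by
        rw [← Real.rpow_add h0, one_div, one_div, hpq.symm.inv_add_inv_eq_one, Real.rpow_one]
      nth_rewrite 1 [h6] at h1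
      exact le_of_mul_le_mul_right h1 (by positivity)

theorem IsConvexDomain.normTorsion_eq (h : IsConvexDomain Ω) (hD : D ≠ 0) (hp : 1 < p) :
    normTorsion p Ω = volume.real Ω ^ (p - 1) / torsionConst p Ω ^ p := by
  obtain ⟨q, hpq⟩ : ∃ q, p.HolderConjugate q := ⟨_, Real.HolderConjugate.conjExponent hp⟩
  have hex := h.exists_isTorsionFunction hD hp
  obtain ⟨h0, h1⟩ := h.torsionConst_eq hD hpq hex.choose_spec
  have hC0 := h.torsionConst_pos hD hp
  rw [normTorsion, torsionalRigidity, dif_pos hex, h1, ← Real.rpow_mul h0, div_eq_mul_inv,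
    ← Real.rpow_neg h0]
  congr 2
  rw [one_div_mul_eq_div, hpq.div_conj_eq_sub_one]
  ring

end Torsion

/-! ### Scaling and the dilation invariant shape ratio. -/

namespace Torsion

section Scaling

open scoped Pointwise

variable {D : ℕ} {p : ℝ} {Ω : Set (E D)} {t : ℝ}

theorem IsConvexDomain.smul (h : IsConvexDomain Ω) (ht : 0 < t) : IsConvexDomain (t • Ω) :=
  ⟨h.isOpen.smul₀ ht.ne', h.isBounded.smul₀ t, h.convex.smul t, h.nonempty.smul_set⟩

theorem volume_real_smul (ht : 0 < t) (Ω : Set (E D)) :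
    volume.real (t • Ω) = t ^ D * volume.real Ω := by
  rw [Measure.real, Measure.addHaar_smul, ENNReal.toReal_mul, finrank_euclideanSpace_fin,
    ENNReal.toReal_ofReal (abs_nonneg _), abs_of_pos (by positivity), Measure.real]

theorem setIntegral_smul_set {F : Type*} [NormedAddCommGroup F] [NormedSpace ℝ F] (ht : 0 < t)
    (Ω : Set (E D)) (f : E D → F) :
    ∫ x in t • Ω, f x = t ^ D • ∫ x in Ω, f (t • x) := by
  rw [Measure.setIntegral_comp_smul_of_pos _ _ _ ht, finrank_euclideanSpace_fin, smul_smul,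
    mul_inv_cancel₀ (by positivity), one_smul]

theorem avgDist_smul (ht : 0 < t) (Ω : Set (E D)) : avgDist (t • Ω) = t * avgDist Ω := by
  have hf : frontier (t • Ω) = t • frontier Ω :=
    ((Homeomorph.smulOfNeZero t ht.ne').image_frontier Ω).symm
  rw [avgDist, avgDist, setIntegral_smul_set ht, volume_real_smul ht, hf]
  simp only [Metric.infDist, infEDist_smul₀ ht.ne', ENNReal.toReal_smul, NNReal.smul_def, coe_nnnorm,
    Real.norm_of_nonneg ht.le, smul_eq_mul, integral_const_mul]
  have : t ^ D ≠ 0 := by positivity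
  by_cases hv : volume.real Ω = 0
  · simp [hv]
  · field_simp

theorem IsTestFunction.comp_smul (ht : t ≠ 0) {φ : E D → ℝ} (h : IsTestFunction (t • Ω) φ) :
    IsTestFunction Ω fun x => φ (t • x) where
  smooth := h.smooth.comp (contDiff_const_smul t)
  compact := h.compact.comp_smul ht
  support := by
    have := tsupport_comp_eq_preimage φ (Homeomorph.smulOfNeZero t ht)
    intro x hx
    have hx' : x ∈ Homeomorph.smulOfNeZero t ht ⁻¹' tsupport φ := this ▸ hx
    exact (Set.smul_mem_smul_set_iff₀ ht Ω x).1 (h.support hx')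

theorem gradient_comp_smul (φ : E D → ℝ) (x : E D) :
    gradient (fun y => φ (t • y)) x = t • gradient φ (t • x) := by
  rw [gradient, gradient, fderiv_comp_smul, map_smul]

/-- The integral scales with exponent `D` and the energy norm with `D/p - 1`; their difference is
`D/q + 1`. -/
theorem IsTorsionBound.smul {q : ℝ} (hpq : p.HolderConjugate q) (ht : 0 < t) {C : ℝ}
    (h : IsTorsionBound p Ω C) : IsTorsionBound p (t • Ω) (t ^ (D / q + 1) * C) := by
  refine ⟨mul_nonneg (by positivity) h.1, fun φ hφ => ?_⟩
  have h1 := h.2 _ (hφ.comp_smul ht.ne')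
  have e : energyNorm p (t • Ω) (gradient φ) =
      t ^ (D / p - 1) * energyNorm p Ω (gradient fun x => φ (t • x)) := by
    have hp0 := hpq.pos
    simp only [energyNorm, gradient_comp_smul, norm_smul, Real.norm_of_nonneg ht.le,
      Real.mul_rpow ht.le (norm_nonneg _), integral_const_mul]
    rw [setIntegral_smul_set ht, smul_eq_mul, Real.mul_rpow (by positivity)
      (integral_nonneg fun _ => by positivity), Real.mul_rpow (by positivity)
      (integral_nonneg fun _ => by positivity), ← Real.rpow_natCast, ← Real.rpow_mul ht.le,
      ← Real.rpow_mul ht.le, ← mul_assoc, ← Real.rpow_add ht, mul_one_div_cancel hp0.ne',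
      mul_one_div]
    ring_nf
  rw [setIntegral_smul_set ht, smul_eq_mul, abs_mul, abs_of_pos (by positivity : (0 : ℝ) < t ^ D), e]
  calc t ^ D * |∫ x in Ω, φ (t • x)|
      ≤ t ^ D * (C * energyNorm p Ω (gradient fun x => φ (t • x))) := by gcongr
    _ = (t ^ (D / q + 1) * t ^ (D / p - 1)) * (C * energyNorm p Ω (gradient fun x => φ (t • x))) := by
        rw [← Real.rpow_add ht, ← Real.rpow_natCast]
        congr 2
        have := hpq.inv_add_inv_eq_one
        rw [div_eq_mul_inv, div_eq_mul_inv]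
        linear_combination (-(D : ℝ)) * this
    _ = _ := by ring

/-- The reverse inequality is the same scaling bound for the dilation by `t⁻¹`. -/
theorem IsConvexDomain.torsionConst_smul (h : IsConvexDomain Ω) (hD : D ≠ 0) {q : ℝ}
    (hpq : p.HolderConjugate q) (ht : 0 < t) :
    torsionConst p (t • Ω) = t ^ (D / q + 1) * torsionConst p Ω := by
  refine le_antisymm (torsionConst_le ((h.isTorsionBound hD hpq.lt).smul hpq ht)) ?_
  have h1 := torsionConst_le (((h.smul ht).isTorsionBound hD hpq.lt).smul hpq (inv_pos.2 ht))
  rw [inv_smul_smul₀ ht.ne', Real.inv_rpow ht.le, ← div_eq_inv_mul,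
    le_div_iff₀ (by positivity)] at h1
  linarith

/-- The scale invariant quantity `δ(Ω) T(p;Ω)^{1/p}`. -/
noncomputable def shapeRatio (p q : ℝ) (Ω : Set (E D)) : ℝ :=
  avgDist Ω * volume.real Ω ^ (1 / q) / torsionConst p Ω

theorem IsConvexDomain.shapeRatio_smul (h : IsConvexDomain Ω) (hD : D ≠ 0) {q : ℝ}
    (hpq : p.HolderConjugate q) (ht : 0 < t) : shapeRatio p q (t • Ω) = shapeRatio p q Ω := by
  have hC := h.torsionConst_pos hD hpq.lt
  rw [shapeRatio, shapeRatio, h.torsionConst_smul hD hpq ht, avgDist_smul ht, volume_real_smul ht,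
    Real.mul_rpow (by positivity) h.volume_pos.le, ← Real.rpow_natCast, ← Real.rpow_mul ht.le,
    Real.rpow_add ht, Real.rpow_one, mul_one_div]
  have : t ^ ((D : ℝ) / q) ≠ 0 := by positivity
  field_simp

/-- This reduces the theorem to one scale-free number: once the average distance is fixed, only the
shape ratio can vary. -/
theorem IsConvexDomain.normTorsion_eq_shapeRatio (h : IsConvexDomain Ω) (hD : D ≠ 0) {q : ℝ}
    (hpq : p.HolderConjugate q) (hδ : 0 < avgDist Ω) :
    normTorsion p Ω = (shapeRatio p q Ω / avgDist Ω) ^ p := by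
  have hC := h.torsionConst_pos hD hpq.lt
  rw [h.normTorsion_eq hD hpq.lt, shapeRatio, mul_div_assoc, mul_div_cancel_left₀ _ hδ.ne',
    Real.div_rpow (by have := h.volume_pos; positivity) hC.le, ← Real.rpow_mul h.volume_pos.le,
    one_div_mul_eq_div, hpq.div_conj_eq_sub_one]

end Scaling

/-! ### Lipschitz trial functions. -/

section LowerBound

variable {D : ℕ} {p : ℝ} {Ω : Set (E D)}

/-- Lipschitz functions vanishing outside `Ω` are admissible in the definition of the torsion
constant, with a pointwise local Lipschitz bound in place of the gradient. -/
theorem IsTorsionBound.integral_le (hp : 1 < p) (ho : IsOpen Ω) (hb : Bornology.IsBounded Ω)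
    {C : ℝ} (hC : IsTorsionBound p Ω C) {v : E D → ℝ} (hv : Continuous v)
    (hvΩ : ∀ x, x ∉ Ω → v x = 0) {g : E D → ℝ} (hg0 : ∀ x ∈ Ω, 0 ≤ g x)
    (hgi : IntegrableOn (fun x => g x ^ p) Ω) {η : ℝ} (hη : 0 < η)
    (hlip : ∀ x ∈ Ω, ∀ y ∈ Metric.ball x η, ∀ z ∈ Metric.ball x η,
      |v y - v z| ≤ g x * ‖y - z‖) :
    ∫ x in Ω, v x ≤ C * (∫ x in Ω, g x ^ p) ^ (1 / p) := by
  have hfm := isFiniteMeasure_restrict hb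
  have main : ∀ ε > 0, ∫ x in Ω, v x ≤ C * (∫ x in Ω, g x ^ p) ^ (1 / p) + ε * volume.real Ω := by
    intro ε hε
    -- Cutting off at height `ε` makes the support a compact subset of `Ω`, which leaves room to
    -- mollify; the integral drops by at most `ε |Ω|`.
    set f : E D → ℝ := fun x => max (v x - ε) 0 with hf
    have hfc : Continuous f := by fun_prop
    have hfsub : tsupport f ⊆ {x | ε ≤ v x} := by
      refine closure_minimal ?_ (isClosed_le continuous_const hv)
      intro x hx
      by_contra! hlt
      simp only [Set.mem_ofPred_eq, not_le] at hlt
      exact hx (max_eq_right (by linarith))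
    have hfΩ : tsupport f ⊆ Ω := fun x hx => by
      by_contra hxΩ
      have h1 : ε ≤ v x := hfsub hx
      rw [hvΩ x hxΩ] at h1
      linarith
    have hfcs : HasCompactSupport f :=
      Metric.isCompact_of_isClosed_isBounded (isClosed_tsupport f) (hb.subset hfΩ)
    have hfi : Integrable f := hfc.integrable_of_hasCompactSupport hfcs
    obtain ⟨δ', hδ', hδsub⟩ := hfcs.isCompact.exists_cthickening_subset_open ho hfΩ
    -- The radius `δ'` keeps the mollified support inside `Ω`; `η / 2` keeps the shifted points in
    -- the ball where the Lipschitz bound `g x` is valid.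
    set δ := min δ' (η / 2) with hδ
    have hδ0 : 0 < δ := lt_min hδ' (by positivity)
    let b : ContDiffBump (0 : E D) := ⟨δ / 2, δ, by positivity, by linarith⟩
    set ρ := b.normed volume with hρ
    set φ := convolution ρ f (ContinuousLinearMap.lsmul ℝ ℝ) volume with hφdef
    have hφx : ∀ x, φ x = ∫ s, ρ s * f (x - s) := fun x => by
      rw [hφdef, convolution_def]; rfl
    have hρi : Integrable ρ := b.integrable_normed
    have hρcs : HasCompactSupport ρ := b.hasCompactSupport_normed
    have hρc : Continuous ρ := b.continuous_normed
    have hρs : ∀ s, ρ s ≠ 0 → ‖s‖ < δ := fun s hs => by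
      have : s ∈ Function.support ρ := hs
      rw [hρ, b.support_normed_eq] at this
      simpa using this
    have hφ : IsTestFunction Ω φ := by
      refine ⟨hρcs.contDiff_convolution_left _ b.contDiff_normed hfi.locallyIntegrable,
        hρcs.convolution _ hfcs, ?_⟩
      refine (closure_minimal ?_ Metric.isClosed_cthickening).trans hδsub
      intro x hx
      obtain ⟨s, hs, y, hy, rfl⟩ := Set.mem_add.1 (support_convolution_subset _ hx)
      refine Metric.mem_cthickening_of_dist_le (s + y) y δ' _ (subset_tsupport f hy) ?_
      rw [dist_eq_norm, add_sub_cancel_right]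
      exact (hρs s hs).le.trans (min_le_left _ _)
    have hint : ∫ x in Ω, φ x = ∫ x in Ω, f x := by
      rw [setIntegral_eq_integral_of_forall_compl_eq_zero fun x hx => hφ.eq_zero hx,
        setIntegral_eq_integral_of_forall_compl_eq_zero (f := f) fun x hx =>
          image_eq_zero_of_notMem_tsupport fun h => hx (hfΩ h),
        hφdef, integral_convolution _ hρi hfi, hρ, b.integral_normed]
      simp
    -- The mollification is an average of translates, all with local Lipschitz constant `g x` near
    -- `x`.
    have hgrad : ∀ x ∈ Ω, ‖gradient φ x‖ ≤ g x := by
      intro x hx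
      rw [norm_gradient_eq]
      refine norm_fderiv_le_of_lip' ℝ (hg0 x hx) ?_
      filter_upwards [Metric.ball_mem_nhds x (half_pos hη)] with y hy
      have hi : ∀ z, Integrable fun s => ρ s * f (z - s) := fun z =>
        (hρc.mul (hfc.comp (continuous_const.sub continuous_id))).integrable_of_hasCompactSupport
          hρcs.mul_right
      rw [hφx, hφx, ← integral_sub (hi y) (hi x)]
      have hbd : ∀ s, ‖ρ s * f (y - s) - ρ s * f (x - s)‖ ≤ ρ s * (g x * ‖y - x‖) := by
        intro s
        rw [← mul_sub, norm_mul, Real.norm_of_nonneg (b.nonneg_normed s)]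
        by_cases hs : ρ s = 0
        · have hs' : b.normed volume s = 0 := hs
          simp [hs, hs']
        refine mul_le_mul_of_nonneg_left ?_ (b.nonneg_normed s)
        have hs' : ‖s‖ < η / 2 := (hρs s hs).trans_le (min_le_right _ _)
        have h1 := hlip x hx (y - s) (by
          rw [mem_ball_iff_norm] at hy ⊢
          calc ‖y - s - x‖ = ‖(y - x) - s‖ := by congr 1; abel
            _ ≤ ‖y - x‖ + ‖s‖ := norm_sub_le _ _
            _ < η := by linarith) (x - s) (by
          rw [mem_ball_iff_norm, sub_sub_cancel_left, norm_neg]; linarith)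
        rw [sub_sub_sub_cancel_right] at h1
        refine le_trans ?_ h1
        rw [Real.norm_eq_abs]
        refine (abs_max_sub_max_le_abs _ _ _).trans (le_of_eq ?_)
        congr 1
        ring
      refine (norm_integral_le_of_norm_le (hρi.mul_const _) (ae_of_all _ hbd)).trans ?_
      rw [integral_mul_const, hρ, b.integral_normed, one_mul]
    have h1 := (le_abs_self _).trans (hC.2 φ hφ)
    have h2 : energyNorm p Ω (gradient φ) ≤ (∫ x in Ω, g x ^ p) ^ (1 / p) := by
      refine Real.rpow_le_rpow (integral_nonneg fun _ => by positivity) ?_ (by positivity)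
      refine integral_mono_of_nonneg (ae_of_all _ fun _ => by positivity) hgi ?_
      filter_upwards [ae_restrict_mem ho.measurableSet] with x hx
      exact Real.rpow_le_rpow (norm_nonneg _) (hgrad x hx) (by positivity)
    have hvi : IntegrableOn v Ω := by
      refine IntegrableOn.mono_set (hv.continuousOn.integrableOn_compact ?_) subset_closure
      exact Metric.isCompact_of_isClosed_isBounded isClosed_closure hb.closure
    have h3 : ∫ x in Ω, v x ≤ ∫ x in Ω, (f x + ε) := by
      refine integral_mono hvi (hfi.restrict.add (integrable_const ε)) fun x => ?_
      have := le_max_left (v x - ε) 0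
      simp only [hf]
      linarith
    rw [integral_add hfi.restrict (integrable_const ε), integral_const,
      measureReal_restrict_apply_univ, smul_eq_mul, ← hint] at h3
    have h4 := mul_le_mul_of_nonneg_left h2 hC.1
    linarith [mul_comm ε (volume.real Ω)]
  refine le_of_forall_pos_le_add fun ε hε => ?_
  have hV : 0 ≤ volume.real Ω := measureReal_nonneg
  have h := main (ε / (volume.real Ω + 1)) (by positivity)
  refine h.trans ?_
  gcongr
  rw [div_mul_eq_mul_div, div_le_iff₀ (by positivity)]
  nlinarith

end LowerBound

end Torsion

/-! ### The distance function and the two-sided bound for the shape ratio. -/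

namespace Torsion

variable {D : ℕ} {p q : ℝ} {Ω : Set (E D)}

theorem IsConvexDomain.ne_univ (h : IsConvexDomain Ω) (hD : D ≠ 0) : Ω ≠ Set.univ := by
  intro hu
  have := frontier_nonempty_of_isBounded hD h.isBounded h.nonempty
  rw [hu, frontier_univ] at this
  exact Set.not_nonempty_empty this

/-- The distance to the complement agrees with the boundary distance inside, and it also vanishes
outside `Ω`, so it can serve as a trial function. -/
theorem IsConvexDomain.infDist_frontier (h : IsConvexDomain Ω) (hD : D ≠ 0) {x : E D} (hx : x ∈ Ω) :
    Metric.infDist x (frontier Ω) = Metric.infDist x Ωᶜ := by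
  apply le_antisymm
  · obtain ⟨y, hy, hxy⟩ := exists_mem_frontier_infDist_compl_eq_dist hx (h.ne_univ hD)
    rw [hxy]
    exact Metric.infDist_le_dist_of_mem hy
  · refine Metric.infDist_le_infDist_of_subset ?_
      (frontier_nonempty_of_isBounded hD h.isBounded h.nonempty)
    rw [h.isOpen.frontier_eq]
    exact fun y hy => hy.2

theorem IsConvexDomain.avgDist_eq (h : IsConvexDomain Ω) (hD : D ≠ 0) :
    avgDist Ω = (1 / volume.real Ω) * ∫ x in Ω, Metric.infDist x Ωᶜ := by
  rw [avgDist, setIntegral_congr_fun h.isOpen.measurableSet fun x hx => h.infDist_frontier hD hx]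

theorem IsConvexDomain.infDist_pos (h : IsConvexDomain Ω) (hD : D ≠ 0) {x : E D} (hx : x ∈ Ω) :
    0 < Metric.infDist x Ωᶜ :=
  (h.isOpen.isClosed_compl.notMem_iff_infDist_pos (Set.nonempty_compl.2 (h.ne_univ hD))).1
    (by simpa using hx)

theorem integrableOn_of_continuous (hb : Bornology.IsBounded Ω) {f : E D → ℝ} (hf : Continuous f) :
    IntegrableOn f Ω :=
  IntegrableOn.mono_set (hf.continuousOn.integrableOn_compact
    (Metric.isCompact_of_isClosed_isBounded isClosed_closure hb.closure)) subset_closure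

/-- The convex combination of two inscribed balls is a ball inside `Ω`, with the combined centre and
radius; a displacement `w` is split between the two balls in proportion to their radii. -/
theorem IsConvexDomain.concaveOn_infDist_compl (h : IsConvexDomain Ω) (hD : D ≠ 0) :
    ConcaveOn ℝ Ω fun x => Metric.infDist x Ωᶜ := by
  refine ⟨h.convex, fun x hx y hy a b ha hb hab => ?_⟩
  have hx0 := h.infDist_pos hD hx
  have hy0 := h.infDist_pos hD hy
  have hmem : ∀ {z w : E D}, ‖w‖ < Metric.infDist z Ωᶜ → z + w ∈ Ω := by
    intro z w hw
    have : dist z (z + w) < Metric.infDist z Ωᶜ := by simpa [dist_eq_norm] using hw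
    simpa using Metric.notMem_of_dist_lt_infDist this
  simp only [smul_eq_mul]
  set r := a * Metric.infDist x Ωᶜ + b * Metric.infDist y Ωᶜ with hr
  have hr0 : 0 < r := by
    rcases ha.eq_or_lt with h0 | h0
    · have : b = 1 := by linarith
      rw [hr, ← h0, this]; linarith
    · have : 0 ≤ b * Metric.infDist y Ωᶜ := by positivity
      have : 0 < a * Metric.infDist x Ωᶜ := by positivity
      linarith
  rw [Metric.le_infDist (Set.nonempty_compl.2 (h.ne_univ hD))]
  intro z hz
  by_contra! hlt
  apply hz
  set w := z - (a • x + b • y) with hw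
  have hwr : ‖w‖ < r := by rwa [hw, ← dist_eq_norm, dist_comm]
  have hscale : ∀ c : ℝ, 0 < c → ‖(c / r) • w‖ < c := by
    intro c hc
    rw [norm_smul, Real.norm_of_nonneg (by positivity), div_mul_eq_mul_div, div_lt_iff₀ hr0]
    gcongr
  have := h.convex (hmem (hscale _ hx0)) (hmem (hscale _ hy0)) ha hb hab
  convert! this using 1
  have e : a • (Metric.infDist x Ωᶜ / r) • w + b • (Metric.infDist y Ωᶜ / r) • w = w := by
    rw [smul_smul, smul_smul, ← add_smul]
    have : a * (Metric.infDist x Ωᶜ / r) + b * (Metric.infDist y Ωᶜ / r) = 1 := by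
      rw [← mul_div_assoc, ← mul_div_assoc, ← add_div, ← hr, div_self hr0.ne']
    rw [this, one_smul]
  rw [smul_add, smul_add, add_add_add_comm, e, hw]
  abel

/-- The distance to the boundary is at most `D + 1` times its average. -/
theorem IsConvexDomain.infDist_le_avgDist (h : IsConvexDomain Ω) (hD : D ≠ 0) {x : E D}
    (hx : x ∈ Ω) : Metric.infDist x Ωᶜ ≤ (D + 1) * avgDist Ω := by
  set R := Metric.infDist x Ωᶜ with hR
  have hR0 : 0 < R := h.infDist_pos hD hx
  have hV := h.volume_pos
  have hVtop : volume Ω ≠ ⊤ := h.isBounded.measure_lt_top.ne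
  -- By concavity the set where the distance exceeds `t` contains the copy of `Ω` shrunk towards `x`
  -- by the factor `1 - t/R`. At `t = R` the left side is `0`, since `D ≠ 0`.
  have hlevel : ∀ t ∈ Set.Ioc 0 R, ENNReal.ofReal ((1 - t / R) ^ D) * volume Ω ≤
      volume.restrict Ω {y | t < Metric.infDist y Ωᶜ} := by
    intro t ht
    have ht1 : t / R ≤ 1 := (div_le_one hR0).2 ht.2
    have ht0 : 0 < t / R := div_pos ht.1 hR0
    rcases ht1.eq_or_lt with h1 | h1
    · rw [h1]; simp [hD]
    have hsub : AffineMap.homothety x (1 - t / R) '' Ω ⊆ {y | t < Metric.infDist y Ωᶜ} ∩ Ω := by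
      rintro _ ⟨y, hy, rfl⟩
      have e : AffineMap.homothety x (1 - t / R) y = (1 - t / R) • y + (t / R) • x := by
        rw [AffineMap.homothety_apply, vsub_eq_sub, vadd_eq_add, smul_sub, sub_smul, sub_smul]
        simp only [one_smul]
        abel
      rw [e]
      refine ⟨?_, h.convex hy hx (by linarith) ht0.le (by ring)⟩
      have := (h.concaveOn_infDist_compl hD).2 hy hx (by linarith : 0 ≤ 1 - t / R) ht0.le (by ring)
      simp only [smul_eq_mul] at this
      rw [← hR, div_mul_cancel₀ _ hR0.ne'] at this
      have h2 : 0 < (1 - t / R) * Metric.infDist y Ωᶜ :=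
        mul_pos (by linarith) (h.infDist_pos hD hy)
      change t < _
      linarith
    rw [Measure.restrict_apply (measurableSet_lt measurable_const
      (Metric.continuous_infDist_pt _).measurable)]
    refine le_trans (le_of_eq ?_) (measure_mono hsub)
    rw [Measure.addHaar_image_homothety, finrank_euclideanSpace_fin, abs_of_nonneg]
    exact pow_nonneg (by linarith) _
  -- Summing the level sets by the layer cake formula gives this integral, which is where `D + 1`
  -- comes from.
  have hint : ∫ t in (0 : ℝ)..R, (1 - t / R) ^ D = R / (D + 1) := by
    have h1 : ∀ t, HasDerivAt (fun t : ℝ => -(R / (D + 1)) * (1 - t / R) ^ (D + 1))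
        ((1 - t / R) ^ D) t := by
      intro t
      have h2 : HasDerivAt (fun t : ℝ => 1 - t / R) (-(1 / R)) t := by
        simpa using ((hasDerivAt_id t).div_const R).const_sub 1
      convert! (h2.pow (D + 1)).const_mul (-(R / (D + 1))) using 1
      have : (D : ℝ) + 1 ≠ 0 := by positivity
      push_cast
      field_simp
    rw [intervalIntegral.integral_eq_sub_of_hasDerivAt (fun t _ => h1 t)
      ((by fun_prop : Continuous fun t : ℝ => (1 - t / R) ^ D).intervalIntegrable _ _)]
    simp [hR0.ne']
  have hmain : ENNReal.ofReal (R / (D + 1)) * volume Ω ≤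
      ∫⁻ y in Ω, ENNReal.ofReal (Metric.infDist y Ωᶜ) := by
    rw [lintegral_eq_lintegral_meas_lt _ (ae_of_all _ fun y => Metric.infDist_nonneg)
      (Metric.continuous_infDist_pt _).aemeasurable]
    calc ENNReal.ofReal (R / (D + 1)) * volume Ω
        = ∫⁻ t in Set.Ioc 0 R, ENNReal.ofReal ((1 - t / R) ^ D) * volume Ω := by
          rw [lintegral_mul_const _ (by fun_prop), ← hint,
            intervalIntegral.integral_of_le hR0.le, ofReal_integral_eq_lintegral_ofReal]
          · exact ((by fun_prop : Continuous fun t : ℝ => (1 - t / R) ^ D).integrableOn_Icc).mono_set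
              Set.Ioc_subset_Icc_self
          · filter_upwards [ae_restrict_mem measurableSet_Ioc] with t ht
            exact pow_nonneg (sub_nonneg.2 ((div_le_one hR0).2 ht.2)) _
      _ ≤ ∫⁻ t in Set.Ioc 0 R, volume.restrict Ω {y | t < Metric.infDist y Ωᶜ} :=
          setLIntegral_mono' measurableSet_Ioc hlevel
      _ ≤ _ := lintegral_mono_set Set.Ioc_subset_Ioi_self
  rw [← ofReal_integral_eq_lintegral_ofReal (integrableOn_of_continuous h.isBounded
    (Metric.continuous_infDist_pt _)) (ae_of_all _ fun y => Metric.infDist_nonneg)] at hmain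
  have hmain' := ENNReal.toReal_mono ENNReal.ofReal_ne_top hmain
  rw [ENNReal.toReal_mul, ENNReal.toReal_ofReal (by positivity),
    ENNReal.toReal_ofReal (integral_nonneg fun y => Metric.infDist_nonneg)] at hmain'
  change R / (D + 1) * volume.real Ω ≤ _ at hmain'
  rw [h.avgDist_eq hD, ← mul_assoc, mul_one_div, div_mul_eq_mul_div, le_div_iff₀ hV]
  calc R * volume.real Ω = (D + 1) * (R / (D + 1) * volume.real Ω) := by field_simp
    _ ≤ _ := by gcongr

theorem IsConvexDomain.avgDist_pos (h : IsConvexDomain Ω) (hD : D ≠ 0) : 0 < avgDist Ω := by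
  obtain ⟨x, hx⟩ := h.nonempty
  have h1 := (h.infDist_pos hD hx).trans_le (h.infDist_le_avgDist hD hx)
  exact pos_of_mul_pos_right h1 (by positivity)

/-- The torsion constant is at most the inradius times `|Ω|^{1/q}`, and the inradius is at most `D +
1` times the average distance. -/
theorem IsConvexDomain.one_div_le_shapeRatio (h : IsConvexDomain Ω) (hD : D ≠ 0)
    (hpq : p.HolderConjugate q) : 1 / ((D : ℝ) + 1) ≤ shapeRatio p q Ω := by
  have hδ := h.avgDist_pos hD
  have hV := h.volume_pos
  have hC := h.torsionConst_pos hD hpq.lt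
  have h1 := torsionConst_le (isTorsionBound_of_infDist_le hD hpq h.isOpen h.isBounded h.convex
    (K := (D + 1) * avgDist Ω) (by positivity) fun x hx => by
      rw [h.infDist_frontier hD hx]; exact h.infDist_le_avgDist hD hx)
  rw [shapeRatio, div_le_div_iff₀ (by positivity) hC]
  linarith

/-- The trial function is the distance to the complement, with Lipschitz constant `1`. -/
theorem IsConvexDomain.shapeRatio_le_one (h : IsConvexDomain Ω) (hD : D ≠ 0)
    (hpq : p.HolderConjugate q) : shapeRatio p q Ω ≤ 1 := by
  have hV := h.volume_pos
  have hC := h.torsionConst_pos hD hpq.lt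
  have hfm := isFiniteMeasure_restrict h.isBounded
  have h1 := (h.isTorsionBound hD hpq.lt).integral_le hpq.lt h.isOpen h.isBounded
    (v := fun x => Metric.infDist x Ωᶜ) (g := fun _ => 1) (η := 1)
    (Metric.continuous_infDist_pt _)
    (fun x hx => Metric.infDist_zero_of_mem hx) (fun _ _ => zero_le_one) (integrable_const _) one_pos
    (fun x _ y _ z _ => by
      rw [one_mul, ← dist_eq_norm, ← Real.dist_eq]
      simpa using (Metric.lipschitz_infDist_pt Ωᶜ).dist_le_mul y z)
  simp only [Real.one_rpow, integral_const, measureReal_restrict_apply_univ, smul_eq_mul,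
    mul_one] at h1
  rw [shapeRatio, div_le_one hC, h.avgDist_eq hD]
  have e : volume.real Ω ^ (1 / p) * volume.real Ω ^ (1 / q) = volume.real Ω := by
    rw [← Real.rpow_add hV, one_div, one_div, hpq.inv_add_inv_eq_one, Real.rpow_one]
  calc 1 / volume.real Ω * (∫ x in Ω, Metric.infDist x Ωᶜ) * volume.real Ω ^ (1 / q)
      ≤ 1 / volume.real Ω * (torsionConst p Ω * volume.real Ω ^ (1 / p)) *
          volume.real Ω ^ (1 / q) := by gcongr
    _ = 1 / volume.real Ω * torsionConst p Ω *
          (volume.real Ω ^ (1 / p) * volume.real Ω ^ (1 / q)) := by ring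
    _ = torsionConst p Ω := by rw [e]; field_simp

end Torsion

/-! ### The unit ball. -/

namespace Torsion

variable {D : ℕ} {p q : ℝ}

theorem isConvexDomain_ball : IsConvexDomain (Metric.ball (0 : E D) 1) :=
  ⟨Metric.isOpen_ball, Metric.isBounded_ball, convex_ball _ _, ⟨0, by simp⟩⟩

theorem integral_ball_norm_rpow (hD : D ≠ 0) (hq : 0 < q) :
    ∫ x in Metric.ball (0 : E D) 1, ‖x‖ ^ q = volume.real (Metric.ball (0 : E D) 1) * (D / (D + q)) := by
  have : Nonempty (Fin D) := ⟨⟨0, Nat.pos_of_ne_zero hD⟩⟩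
  have h1 := integral_fun_norm_addHaar (volume : Measure (E D))
    ((Set.Iio (1 : ℝ)).indicator fun t => t ^ q)
  have e1 : ∀ x : E D, (Set.Iio (1 : ℝ)).indicator (fun t => t ^ q) ‖x‖ =
      (Metric.ball (0 : E D) 1).indicator (fun x => ‖x‖ ^ q) x := by
    intro x
    simp [Set.indicator]
  simp only [e1] at h1
  rw [integral_indicator measurableSet_ball, finrank_euclideanSpace_fin] at h1
  have e2 : ∀ y ∈ Set.Ioi (0 : ℝ), y ^ (D - 1) • (Set.Iio (1 : ℝ)).indicator (fun t => t ^ q) y =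
      (Set.Iio (1 : ℝ)).indicator (fun t => t ^ ((D : ℝ) - 1 + q)) y := by
    intro y hy
    by_cases h : y ∈ Set.Iio (1 : ℝ)
    · rw [Set.indicator_of_mem h, Set.indicator_of_mem h, smul_eq_mul, Real.rpow_add hy,
        ← Real.rpow_natCast, Nat.cast_sub (Nat.one_le_iff_ne_zero.2 hD), Nat.cast_one]
    · rw [Set.indicator_of_notMem h, Set.indicator_of_notMem h, smul_zero]
  have hD' : (1 : ℝ) ≤ D := by exact_mod_cast Nat.one_le_iff_ne_zero.2 hD
  have e3 : ∫ y in Set.Ioi (0 : ℝ), y ^ (D - 1) • (Set.Iio (1 : ℝ)).indicator (fun t => t ^ q) y =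
      1 / (D + q) := by
    rw [setIntegral_congr_fun measurableSet_Ioi e2, setIntegral_indicator measurableSet_Iio,
      Set.Ioi_inter_Iio, ← integral_Ioc_eq_integral_Ioo, ← intervalIntegral.integral_of_le zero_le_one,
      integral_rpow (Or.inl (by linarith)), Real.one_rpow, Real.zero_rpow (by linarith)]
    ring_nf
  rw [e3] at h1
  rw [h1]
  simp only [nsmul_eq_mul, smul_eq_mul]
  ring

theorem infDist_ball_compl (hD : D ≠ 0) {x : E D} (hx : x ∈ Metric.ball (0 : E D) 1) :
    Metric.infDist x (Metric.ball (0 : E D) 1)ᶜ = 1 - ‖x‖ := by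
  have hx' : ‖x‖ < 1 := by simpa using hx
  apply le_antisymm
  · obtain ⟨e, he, hxe⟩ : ∃ e : E D, ‖e‖ = 1 ∧ x = ‖x‖ • e := by
      by_cases h0 : x = 0
      · have : Nonempty (Fin D) := ⟨⟨0, Nat.pos_of_ne_zero hD⟩⟩
        obtain ⟨e, he⟩ := exists_norm_eq (E D) zero_le_one
        exact ⟨e, he, by simp [h0]⟩
      · have hn : ‖x‖ ≠ 0 := norm_ne_zero_iff.2 h0
        refine ⟨‖x‖⁻¹ • x, ?_, ?_⟩
        · rw [norm_smul, norm_inv, norm_norm, inv_mul_cancel₀ hn]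
        · rw [smul_inv_smul₀ hn]
    refine (Metric.infDist_le_dist_of_mem (y := e) (by simp [he])).trans (le_of_eq ?_)
    nth_rewrite 1 [hxe]
    rw [dist_comm, dist_eq_norm]
    have : e - ‖x‖ • e = (1 - ‖x‖) • e := by rw [sub_smul, one_smul]
    rw [this, norm_smul, he, mul_one, Real.norm_of_nonneg (by linarith)]
  · rw [Metric.le_infDist (Set.nonempty_compl.2 (isConvexDomain_ball.ne_univ hD))]
    intro y hy
    have hy' : 1 ≤ ‖y‖ := by simpa using hy
    rw [dist_comm, dist_eq_norm]
    linarith [norm_sub_norm_le y x]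

theorem avgDist_ball (hD : D ≠ 0) : avgDist (Metric.ball (0 : E D) 1) = 1 / (D + 1) := by
  have hV := (isConvexDomain_ball (D := D)).volume_pos
  rw [isConvexDomain_ball.avgDist_eq hD, setIntegral_congr_fun measurableSet_ball
    fun x hx => infDist_ball_compl hD hx]
  have h1 := integral_ball_norm_rpow (D := D) hD one_pos
  simp only [Real.rpow_one] at h1
  have hfm := isFiniteMeasure_restrict (isConvexDomain_ball (D := D)).isBounded
  rw [integral_sub (integrable_const _) (integrableOn_of_continuous
    isConvexDomain_ball.isBounded continuous_norm), h1, integral_const,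
    measureReal_restrict_apply_univ, smul_eq_mul]
  field_simp
  ring

/-- The divergence theorem for the field `x`, whose divergence is `D`, done by parts in each
coordinate. -/
theorem integral_eq_neg_integral_inner {Ω : Set (E D)} {φ : E D → ℝ} (hφ : IsTestFunction Ω φ) :
    (D : ℝ) * ∫ x, φ x = -∫ x, inner ℝ x (gradient φ x) := by
  have hcd := hφ.contDiff_one.continuous_fderiv one_ne_zero
  set e : Fin D → E D := fun i => EuclideanSpace.single i 1 with he
  have hcoord : ∀ i (x : E D), fderiv ℝ (fun y : E D => y i) x (e i) = 1 := by
    intro i x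
    have : HasFDerivAt (fun y : E D => y i) (EuclideanSpace.proj i : E D →L[ℝ] ℝ) x :=
      (EuclideanSpace.proj i : E D →L[ℝ] ℝ).hasFDerivAt
    rw [this.fderiv]
    simp [he]
  have hcc : ∀ i, Continuous fun y : E D => y i := fun i =>
    (EuclideanSpace.proj i : E D →L[ℝ] ℝ).continuous
  have hi : ∀ i, Integrable fun x : E D => x i * fderiv ℝ φ x (e i) := fun i =>
    ((hcc i).mul (by fun_prop)).integrable_of_hasCompactSupport
      (((hφ.compact.fderiv ℝ).comp_left (g := fun L : E D →L[ℝ] ℝ => L (e i)) (by simp)).mul_left)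
  have h1 : ∀ i, ∫ x : E D, x i * fderiv ℝ φ x (e i) = -∫ x, φ x := by
    intro i
    rw [integral_mul_fderiv_eq_neg_fderiv_mul_of_integrable _ (hi i) _
      (fun x _ => (EuclideanSpace.proj i : E D →L[ℝ] ℝ).differentiableAt)
      (fun x _ => hφ.differentiable x)]
    · simp only [hcoord, one_mul]
    · simp only [hcoord, one_mul]
      exact hφ.continuous.integrable_of_hasCompactSupport hφ.compact
    · exact ((hcc i).mul hφ.continuous).integrable_of_hasCompactSupport hφ.compact.mul_left
  have h2 : ∀ x, inner ℝ x (gradient φ x) = ∑ i, x i * fderiv ℝ φ x (e i) := by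
    intro x
    rw [real_inner_comm, inner_gradient]
    have hx : x = ∑ i, x i • e i := by
      ext j
      simp [he, Pi.single_apply]
    have h3 := congrArg (fderiv ℝ φ x) hx
    simpa only [map_sum, map_smul, smul_eq_mul] using h3
  simp only [h2]
  rw [integral_finsetSum _ fun i _ => hi i]
  simp only [h1, Finset.sum_const, Finset.card_univ, Fintype.card_fin, nsmul_eq_mul]
  ring

/-- A dual bound: the field `x / D` has divergence `1`, so Hölder bounds the torsion constant by its
`L^q` norm. The flux of the radial torsion function is this field up to sign, but only the upper
bound is used. -/
theorem isTorsionBound_ball (hD : D ≠ 0) (hpq : p.HolderConjugate q) :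
    IsTorsionBound p (Metric.ball (0 : E D) 1)
      (1 / D * (volume.real (Metric.ball (0 : E D) 1) * (D / (D + q))) ^ (1 / q)) := by
  have hq := hpq.symm.pos
  refine ⟨by positivity, fun φ hφ => ?_⟩
  have hD0 : (0 : ℝ) < D := by exact_mod_cast Nat.pos_of_ne_zero hD
  have h1 := integral_eq_neg_integral_inner hφ
  rw [← setIntegral_eq_integral_of_forall_compl_eq_zero fun x hx => hφ.eq_zero hx,
    ← setIntegral_eq_integral_of_forall_compl_eq_zero (s := Metric.ball (0 : E D) 1)
    (f := fun x => inner ℝ x (gradient φ x)) fun x hx => by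
      simp only [hφ.gradient_eq_zero hx, inner_zero_right]] at h1
  have hb := (isConvexDomain_ball (D := D)).isBounded
  have hfm := isFiniteMeasure_restrict hb
  have hw : MemLp (fun x : E D => ‖x‖) (ENNReal.ofReal q)
      (volume.restrict (Metric.ball (0 : E D) 1)) := by
    refine MemLp.of_bound (by fun_prop) 1 ?_
    filter_upwards [ae_restrict_mem measurableSet_ball] with x hx
    rw [norm_norm]
    exact (by simpa using hx : ‖x‖ < 1).le
  have h2 := integral_mul_le_energyNorm hpq (fun x => norm_nonneg x) hw
    (hφ.memLp_gradient (ENNReal.ofReal p))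
  rw [integral_ball_norm_rpow hD hq] at h2
  have h3 : |∫ x in Metric.ball (0 : E D) 1, inner ℝ x (gradient φ x)| ≤
      ∫ x in Metric.ball (0 : E D) 1, ‖x‖ * ‖gradient φ x‖ := by
    refine abs_integral_le_integral_abs.trans ?_
    refine integral_mono_of_nonneg (ae_of_all _ fun _ => abs_nonneg _) ?_
      (ae_of_all _ fun x => abs_real_inner_le_norm _ _)
    exact integrableOn_of_continuous hb (continuous_norm.mul hφ.continuous_gradient.norm)
  have h4 : (D : ℝ) * |∫ x in Metric.ball (0 : E D) 1, φ x| =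
      |∫ x in Metric.ball (0 : E D) 1, inner ℝ x (gradient φ x)| := by
    rw [← abs_neg (∫ x in Metric.ball (0 : E D) 1, inner ℝ x (gradient φ x)), ← h1, abs_mul,
      abs_of_pos hD0]
  rw [mul_assoc, one_div, ← div_eq_inv_mul, le_div_iff₀ hD0, mul_comm, h4]
  exact h3.trans h2

theorem le_shapeRatio_ball (hD : D ≠ 0) (hpq : p.HolderConjugate q) :
    D / (D + 1) * ((D + q) / D) ^ (1 / q) ≤ shapeRatio p q (Metric.ball (0 : E D) 1) := by
  have hq := hpq.symm.pos
  have hD0 : (0 : ℝ) < D := by exact_mod_cast Nat.pos_of_ne_zero hD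
  have hV := (isConvexDomain_ball (D := D)).volume_pos
  have hC := (isConvexDomain_ball (D := D)).torsionConst_pos hD hpq.lt
  rw [shapeRatio, avgDist_ball hD, le_div_iff₀ hC]
  refine (mul_le_mul_of_nonneg_left (torsionConst_le (isTorsionBound_ball hD hpq))
    (by positivity)).trans (le_of_eq ?_)
  rw [Real.mul_rpow hV.le (by positivity)]
  have : ((D + q) / D) ^ (1 / q) * ((D : ℝ) / (D + q)) ^ (1 / q) = 1 := by
    rw [← Real.mul_rpow (by positivity) (by positivity)]
    have : (D + q) / D * ((D : ℝ) / (D + q)) = 1 := by field_simp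
    rw [this, Real.one_rpow]
  calc _ = (1 / (D + 1) * volume.real (Metric.ball (0 : E D) 1) ^ (1 / q)) * ((D : ℝ) * (1 / D)) *
        (((D + q) / D) ^ (1 / q) * ((D : ℝ) / (D + q)) ^ (1 / q)) := by ring
    _ = _ := by rw [this]; field_simp

end Torsion

/-! ### Long boxes, approaching a slab. -/

namespace Torsion

variable {D : ℕ} {p q : ℝ} {Ω : Set (E D)}

theorem abs_rpow_sub_rpow_le (hq : 1 < q) {M a b : ℝ} (ha : a ∈ Set.Icc 0 M) (hb : b ∈ Set.Icc 0 M) :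
    |a ^ q - b ^ q| ≤ q * M ^ (q - 1) * |a - b| := by
  refine Convex.norm_image_sub_le_of_norm_hasDerivWithin_le (f := fun x : ℝ => x ^ q)
    (f' := fun x => q * x ^ (q - 1)) (s := Set.Icc 0 M) (fun x hx => ?_) (fun x hx => ?_)
    (convex_Icc 0 M) hb ha
  · exact (Real.hasDerivAt_rpow_const (Or.inr hq.le)).hasDerivWithinAt
  · rw [Real.norm_of_nonneg (mul_nonneg (by linarith) (Real.rpow_nonneg hx.1 _))]
    exact mul_le_mul_of_nonneg_left (Real.rpow_le_rpow hx.1 hx.2 (by linarith)) (by linarith)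

/-- A lower bound for the torsion constant, from a test function that depends only on the distance
to the boundary. -/
theorem IsConvexDomain.integral_dist_le (h : IsConvexDomain Ω) (hD : D ≠ 0)
    (hpq : p.HolderConjugate q) (h1 : ∀ x, Metric.infDist x Ωᶜ ≤ 1) :
    ∫ x in Ω, (1 - (1 - Metric.infDist x Ωᶜ) ^ q) / q ≤
      torsionConst p Ω * (∫ x in Ω, (1 - Metric.infDist x Ωᶜ) ^ q) ^ (1 / p) := by
  have hq := hpq.symm.lt
  have hp0 := hpq.pos
  have hfm := isFiniteMeasure_restrict h.isBounded
  have hC := h.isTorsionBound hD hpq.lt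
  set d : E D → ℝ := fun x => Metric.infDist x Ωᶜ with hd
  have hdc : Continuous d := Metric.continuous_infDist_pt _
  have hd0 : ∀ x, 0 ≤ d x := fun x => Metric.infDist_nonneg
  have hdl : ∀ x y, |d x - d y| ≤ ‖x - y‖ := fun x y => by
    rw [← dist_eq_norm, ← Real.dist_eq]
    simpa using (Metric.lipschitz_infDist_pt Ωᶜ).dist_le_mul x y
  have hpc : ∀ c : ℝ, Continuous fun x => (1 - d x + c) ^ q := fun c =>
    ((continuous_const.sub hdc).add continuous_const).rpow_const fun _ => Or.inr (by linarith)
  -- With `1 - d` in place of `|t|`, the trial function is the one-dimensional torsion profile `(1 -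
  -- |t|^q)/q` of `(-1, 1)`. On a ball of radius `η` its Lipschitz constant is at most `(1 - d +
  -- η)^{q-1}`, and `(q-1) p = q`; afterwards `η → 0`.
  have key : ∀ η ∈ Set.Ioo (0 : ℝ) 1, ∫ x in Ω, (1 - (1 - d x) ^ q) / q ≤
      torsionConst p Ω * (∫ x in Ω, (1 - d x + η) ^ q) ^ (1 / p) := by
    intro η hη
    have hg : ∀ x, ((1 - d x + η) ^ (q - 1)) ^ p = (1 - d x + η) ^ q := fun x => by
      rw [← Real.rpow_mul (by linarith [h1 x, hη.1]), hpq.symm.sub_one_mul_conj]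
    have := hC.integral_le hpq.lt h.isOpen h.isBounded (v := fun x => (1 - (1 - d x) ^ q) / q)
      (g := fun x => (1 - d x + η) ^ (q - 1)) (η := η) ?_ ?_ ?_ ?_ hη.1 ?_
    · simpa only [hg] using this
    · have := hpc 0
      simp only [add_zero] at this
      fun_prop
    · intro x hx
      have : d x = 0 := Metric.infDist_zero_of_mem hx
      simp [this]
    · intro x _
      exact Real.rpow_nonneg (by linarith [h1 x, hη.1]) _
    · simp only [hg]
      exact integrableOn_of_continuous h.isBounded (hpc η)
    · intro x _ y hy z hz
      have hmem : ∀ w ∈ Metric.ball x η, 1 - d w ∈ Set.Icc 0 (1 - d x + η) := by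
        intro w hw
        rw [mem_ball_iff_norm] at hw
        have := (abs_le.1 (hdl w x)).1
        exact ⟨by linarith [h1 w], by linarith⟩
      have h2 := abs_rpow_sub_rpow_le hq (hmem z hz) (hmem y hy)
      have e1 : (1 - (1 - d y) ^ q) / q - (1 - (1 - d z) ^ q) / q =
          ((1 - d z) ^ q - (1 - d y) ^ q) / q := by ring
      have e2 : |1 - d z - (1 - d y)| = |d y - d z| := by congr 1; ring
      rw [e1, abs_div, abs_of_pos (by linarith : 0 < q), div_le_iff₀ (by linarith)]
      rw [e2] at h2
      have h3 : 0 ≤ (1 - d x + η) ^ (q - 1) := Real.rpow_nonneg (by linarith [h1 x, hη.1]) _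
      calc _ ≤ q * (1 - d x + η) ^ (q - 1) * |d y - d z| := h2
        _ ≤ q * (1 - d x + η) ^ (q - 1) * ‖y - z‖ := by gcongr; exact hdl y z
        _ = _ := by ring
  have i0 : IntegrableOn (fun x => (1 - d x) ^ q) Ω := by
    have := integrableOn_of_continuous h.isBounded (hpc 0)
    simpa only [add_zero] using this
  set I := ∫ x in Ω, (1 - d x) ^ q with hI
  have key2 : ∀ η ∈ Set.Ioo (0 : ℝ) 1, ∫ x in Ω, (1 - (1 - d x) ^ q) / q ≤
      torsionConst p Ω * (I + q * 2 ^ (q - 1) * η * volume.real Ω) ^ (1 / p) := by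
    intro η hη
    refine (key η hη).trans (mul_le_mul_of_nonneg_left ?_ hC.1)
    refine Real.rpow_le_rpow (integral_nonneg fun x =>
      Real.rpow_nonneg (by linarith [h1 x, hη.1]) _) ?_ (by positivity)
    have : ∫ x in Ω, ((1 - d x) ^ q + q * 2 ^ (q - 1) * η) =
        I + q * 2 ^ (q - 1) * η * volume.real Ω := by
      rw [integral_add i0 (integrable_const _), integral_const, measureReal_restrict_apply_univ,
        smul_eq_mul]
      ring
    rw [← this]
    refine integral_mono (integrableOn_of_continuous h.isBounded (hpc η))
      (i0.add (integrable_const _)) fun x => ?_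
    have h2 := abs_rpow_sub_rpow_le hq (M := 2) (a := 1 - d x + η) (b := 1 - d x)
      ⟨by linarith [h1 x, hη.1], by linarith [hd0 x, hη.2]⟩
      ⟨by linarith [h1 x], by linarith [hd0 x]⟩
    rw [add_sub_cancel_left, abs_of_pos hη.1] at h2
    have := le_abs_self ((1 - d x + η) ^ q - (1 - d x) ^ q)
    simp only
    linarith
  have hlim : Tendsto (fun η : ℝ => torsionConst p Ω *
      (I + q * 2 ^ (q - 1) * η * volume.real Ω) ^ (1 / p)) (𝓝[>] 0)
      (𝓝 (torsionConst p Ω * I ^ (1 / p))) := by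
    have hc : Continuous fun η : ℝ => torsionConst p Ω *
      (I + q * 2 ^ (q - 1) * η * volume.real Ω) ^ (1 / p) := by
      refine continuous_const.mul (Continuous.rpow_const (by fun_prop) fun _ => Or.inr ?_)
      positivity
    have := hc.tendsto 0
    simp only [mul_zero, zero_mul, add_zero] at this
    exact this.mono_left nhdsWithin_le_nhds
  refine ge_of_tendsto hlim ?_
  filter_upwards [Ioo_mem_nhdsGT (zero_lt_one (α := ℝ))] with η hη using key2 η hη

/-- The box `{x | |x i₀| < 1, |x j| < L for j ≠ i₀}`. -/
def box (i₀ : Fin D) (L : ℝ) : Set (E D) := {x | |x i₀| < 1 ∧ ∀ j, j ≠ i₀ → |x j| < L}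

theorem continuous_coord (i : Fin D) : Continuous fun x : E D => x i :=
  (EuclideanSpace.proj i : E D →L[ℝ] ℝ).continuous

theorem abs_coord_le (i : Fin D) (x : E D) : |x i| ≤ ‖x‖ := by
  simpa using PiLp.norm_apply_le x i

theorem isConvexDomain_box (i₀ : Fin D) {L : ℝ} (hL : 0 < L) : IsConvexDomain (box i₀ L) where
  isOpen := by
    have e : box i₀ L = {x | |x i₀| < 1} ∩ ⋂ j, ⋂ (_ : j ≠ i₀), {x : E D | |x j| < L} := by
      ext x; simp [box]
    rw [e]
    refine (isOpen_lt (continuous_coord i₀).abs continuous_const).inter ?_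
    exact isOpen_iInter_of_finite fun j => isOpen_iInter_of_finite fun _ =>
      isOpen_lt (continuous_coord j).abs continuous_const
  isBounded := by
    rw [isBounded_iff_forall_norm_le]
    refine ⟨√(∑ _i : Fin D, (1 + L) ^ 2), fun x hx => ?_⟩
    rw [EuclideanSpace.norm_eq]
    refine Real.sqrt_le_sqrt (Finset.sum_le_sum fun j _ => ?_)
    refine pow_le_pow_left₀ (norm_nonneg _) ?_ 2
    rw [Real.norm_eq_abs]
    by_cases hj : j = i₀
    · rw [hj]; linarith [hx.1]
    · linarith [hx.2 j hj]
  convex := by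
    have e : box i₀ L = {x | |x i₀| < 1} ∩ ⋂ j, ⋂ (_ : j ≠ i₀), {x : E D | |x j| < L} := by
      ext x; simp [box]
    have hs : ∀ (j : Fin D) (r : ℝ), Convex ℝ {x : E D | |x j| < r} := by
      intro j r
      have := (convex_ball (0 : ℝ) r).linear_preimage (EuclideanSpace.proj j : E D →L[ℝ] ℝ).toLinearMap
      convert! this using 1
      ext x
      simp
    rw [e]
    exact (hs i₀ 1).inter (convex_iInter fun j => convex_iInter fun _ => hs j L)
  nonempty := ⟨0, by simp, fun j _ => by simpa using hL⟩

/-- The integrand times the indicator of the box is a product of functions of single coordinates, so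
Fubini applies. -/
theorem integral_box (i₀ : Fin D) {L : ℝ} (hL : 0 < L) (f : ℝ → ℝ) :
    ∫ x in box i₀ L, f (x i₀) = (∫ t in Set.Ioo (-1 : ℝ) 1, f t) * (2 * L) ^ (D - 1) := by
  classical
  set F : Fin D → ℝ → ℝ := fun i => if i = i₀ then (Set.Ioo (-1 : ℝ) 1).indicator f
    else (Set.Ioo (-L) L).indicator 1 with hF
  have e1 : ∀ x : E D, (box i₀ L).indicator (fun x => f (x i₀)) x = ∏ i, F i (x i) := by
    intro x
    rw [← Finset.mul_prod_erase _ _ (Finset.mem_univ i₀)]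
    by_cases hx : x ∈ box i₀ L
    · rw [Set.indicator_of_mem hx, Finset.prod_eq_one fun j hj => ?_]
      · simp only [hF, if_true]
        rw [Set.indicator_of_mem (Set.mem_Ioo.2 (abs_lt.1 hx.1)), mul_one]
      · have hj' := Finset.ne_of_mem_erase hj
        simp only [hF, if_neg hj']
        rw [Set.indicator_of_mem (Set.mem_Ioo.2 (abs_lt.1 (hx.2 j hj'))), Pi.one_apply]
    · rw [Set.indicator_of_notMem hx]
      by_cases h0 : |x i₀| < 1
      · have : ∃ j, j ≠ i₀ ∧ ¬ |x j| < L := by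
          by_contra! hcon
          exact hx ⟨h0, hcon⟩
        obtain ⟨j, hj, hlt⟩ := this
        rw [Finset.prod_eq_zero (Finset.mem_erase.2 ⟨hj, Finset.mem_univ j⟩), mul_zero]
        simp only [hF, if_neg hj]
        exact Set.indicator_of_notMem (fun h : _ ∈ Set.Ioo (-L) L => hlt (abs_lt.2 h)) _
      · simp only [hF, if_true]
        rw [Set.indicator_of_notMem fun h : _ ∈ Set.Ioo (-1 : ℝ) 1 => h0 (abs_lt.2 h), zero_mul]
  rw [← integral_indicator (isConvexDomain_box i₀ hL).isOpen.measurableSet]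
  simp only [e1]
  have h2 := (EuclideanSpace.volume_preserving_symm_measurableEquiv_toLp (Fin D)).integral_comp'
    (f := (MeasurableEquiv.toLp 2 (Fin D → ℝ)).symm) (fun y : Fin D → ℝ => ∏ i, F i (y i))
  refine Eq.trans h2 ?_
  rw [integral_fintype_prod_volume_eq_prod, ← Finset.mul_prod_erase _ _ (Finset.mem_univ i₀)]
  congr 1
  · simp only [hF, if_true]
    exact integral_indicator measurableSet_Ioo
  · rw [Finset.prod_congr rfl (g := fun _ => 2 * L), Finset.prod_const, Finset.card_erase_of_mem
      (Finset.mem_univ _), Finset.card_univ, Fintype.card_fin]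
    intro j hj
    simp only [hF, if_neg (Finset.ne_of_mem_erase hj)]
    rw [integral_indicator measurableSet_Ioo]
    simp [hL.le]
    ring

theorem volume_box (i₀ : Fin D) {L : ℝ} (hL : 0 < L) :
    volume.real (box i₀ L) = 2 * (2 * L) ^ (D - 1) := by
  have := integral_box i₀ hL fun _ => 1
  simp only [integral_const, measureReal_restrict_apply_univ, smul_eq_mul, mul_one] at this
  rw [this]
  norm_num

theorem integral_Ioo_abs_rpow (hq : 0 < q) : ∫ t in Set.Ioo (-1 : ℝ) 1, |t| ^ q = 2 / (q + 1) := by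
  rw [← integral_Ioc_eq_integral_Ioo, ← intervalIntegral.integral_of_le (by norm_num)]
  have hc : Continuous fun t : ℝ => |t| ^ q := continuous_abs.rpow_const fun _ => Or.inr hq.le
  rw [← intervalIntegral.integral_add_adjacent_intervals (b := 0) (hc.intervalIntegrable _ _)
    (hc.intervalIntegrable _ _)]
  have h1 : ∫ t in (0 : ℝ)..1, |t| ^ q = 1 / (q + 1) := by
    have : ∫ t in (0 : ℝ)..1, |t| ^ q = ∫ t in (0 : ℝ)..1, t ^ q := by
      refine intervalIntegral.integral_congr fun t ht => ?_
      rw [Set.uIcc_of_le zero_le_one] at ht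
      simp only [abs_of_nonneg ht.1]
    rw [this, integral_rpow (Or.inl (by linarith)), Real.one_rpow, Real.zero_rpow (by linarith),
      sub_zero]
  have h2 : ∫ t in (-1 : ℝ)..0, |t| ^ q = 1 / (q + 1) := by
    have := intervalIntegral.integral_comp_neg (fun t : ℝ => |t| ^ q) (a := -1) (b := 0)
    simp only [abs_neg, neg_zero, neg_neg] at this
    rw [this, h1]
  rw [h1, h2]
  ring

theorem infDist_box_le (i₀ : Fin D) {L : ℝ} {x : E D} (hx : |x i₀| ≤ 1) :
    Metric.infDist x (box i₀ L)ᶜ ≤ 1 - |x i₀| := by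
  obtain ⟨s, hs, hs'⟩ : ∃ s : ℝ, |x i₀ + s| = 1 ∧ |s| = 1 - |x i₀| := by
    rcases le_total 0 (x i₀) with h | h
    · refine ⟨1 - x i₀, by simp, ?_⟩
      rw [abs_of_nonneg h] at hx ⊢
      exact abs_of_nonneg (by linarith)
    · refine ⟨-1 - x i₀, by simp, ?_⟩
      rw [abs_of_nonpos h] at hx ⊢
      rw [abs_of_nonpos (by linarith)]; ring
  refine (Metric.infDist_le_dist_of_mem (y := x + EuclideanSpace.single i₀ s) ?_).trans ?_
  · intro hmem
    have := hmem.1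
    simp [hs] at this
  · rw [dist_self_add_right, PiLp.norm_single, Real.norm_eq_abs, hs']

theorem infDist_box_le_one (i₀ : Fin D) (L : ℝ) (x : E D) :
    Metric.infDist x (box i₀ L)ᶜ ≤ 1 := by
  by_cases hx : x ∈ box i₀ L
  · have := infDist_box_le (L := L) i₀ hx.1.le
    linarith [abs_nonneg (x i₀)]
  · rw [Metric.infDist_zero_of_mem hx]; exact zero_le_one

/-- At lateral distance at least `1` from the long sides, the two faces `|x i₀| = 1` are nearest, so
the distance is that of the slab. -/
theorem le_infDist_box (i₀ : Fin D) {L : ℝ} (hL : 0 < L) {x : E D} (hx : x ∈ box i₀ (L - 1)) :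
    1 - |x i₀| ≤ Metric.infDist x (box i₀ L)ᶜ := by
  have hD : D ≠ 0 := fun h => by subst h; exact i₀.elim0
  rw [Metric.le_infDist (Set.nonempty_compl.2 ((isConvexDomain_box i₀ hL).ne_univ hD))]
  intro y hy
  by_contra! hlt
  rw [dist_comm, dist_eq_norm] at hlt
  have hj : ∀ j, |y j| < |x j| + (1 - |x i₀|) := fun j => by
    have h1 := abs_coord_le j (y - x)
    have h2 := abs_sub_abs_le_abs_sub (y j) (x j)
    simp only [PiLp.sub_apply] at h1
    linarith
  refine hy ⟨by linarith [hj i₀], fun j hne => ?_⟩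
  linarith [hj j, hx.2 j hne, abs_nonneg (x i₀)]

theorem avgDist_box_le (i₀ : Fin D) {L : ℝ} (hL : 0 < L) : avgDist (box i₀ L) ≤ 1 / 2 := by
  have hD : D ≠ 0 := fun h => by subst h; exact i₀.elim0
  have hbox := isConvexDomain_box i₀ hL
  have hV := hbox.volume_pos
  rw [hbox.avgDist_eq hD, one_div_mul_eq_div, div_le_iff₀ hV, volume_box i₀ hL]
  have h1 : ∫ x in box i₀ L, Metric.infDist x (box i₀ L)ᶜ ≤ ∫ x in box i₀ L, (1 - |x i₀|) := by
    refine setIntegral_mono_on (integrableOn_of_continuous hbox.isBounded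
      (Metric.continuous_infDist_pt _)) (integrableOn_of_continuous hbox.isBounded
      (continuous_const.sub (continuous_coord i₀).abs)) hbox.isOpen.measurableSet fun x hx => ?_
    exact infDist_box_le i₀ hx.1.le
  have h2 := integral_box i₀ hL fun t => 1 - |t|
  have h3 : ∫ t in Set.Ioo (-1 : ℝ) 1, (1 - |t|) = 1 := by
    have h4 := integral_Ioo_abs_rpow one_pos
    simp only [Real.rpow_one] at h4
    have hi : IntegrableOn (fun t : ℝ => |t|) (Set.Ioo (-1) 1) :=
      (continuous_abs.integrableOn_Icc).mono_set Set.Ioo_subset_Icc_self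
    rw [integral_sub (by simp) hi, h4, integral_const]
    norm_num
  rw [h2, h3] at h1
  linarith

/-- On the inner box the integrand is at most that of the slab, with mean `1/(q+1)`; on the rest it
is at most `1`, and the rest has volume fraction `1 - (1 - 1/L)^{D-1}`. -/
theorem integral_box_dist_le (i₀ : Fin D) {L : ℝ} (hL : 1 < L) (hq : 1 < q) :
    ∫ x in box i₀ L, (1 - Metric.infDist x (box i₀ L)ᶜ) ^ q ≤
      volume.real (box i₀ L) * (1 / (q + 1) + 1 - (1 - 1 / L) ^ (D - 1)) := by
  have hL0 : 0 < L := by linarith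
  have hbox := isConvexDomain_box i₀ hL0
  have hbox' := isConvexDomain_box i₀ (by linarith : 0 < L - 1)
  have hfm := isFiniteMeasure_restrict hbox.isBounded
  have hsub : box i₀ (L - 1) ⊆ box i₀ L := fun x hx =>
    ⟨hx.1, fun j hj => (hx.2 j hj).trans (by linarith)⟩
  have hc1 : Continuous fun x : E D => |x i₀| ^ q :=
    (continuous_coord i₀).abs.rpow_const fun _ => Or.inr (by linarith)
  have hi1 := integrableOn_of_continuous hbox.isBounded hc1
  have hi2 : IntegrableOn (fun x => 1 - (box i₀ (L - 1)).indicator (fun _ => (1 : ℝ)) x)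
      (box i₀ L) :=
    (integrable_const _).sub ((integrable_const _).indicator hbox'.isOpen.measurableSet)
  have h1 : ∫ x in box i₀ L, (1 - Metric.infDist x (box i₀ L)ᶜ) ^ q ≤
      ∫ x in box i₀ L, (|x i₀| ^ q + (1 - (box i₀ (L - 1)).indicator (fun _ => (1 : ℝ)) x)) := by
    refine setIntegral_mono_on (integrableOn_of_continuous hbox.isBounded
      ((continuous_const.sub (Metric.continuous_infDist_pt _)).rpow_const
        fun _ => Or.inr (by linarith))) (hi1.add hi2) hbox.isOpen.measurableSet fun x hx => ?_
    have h0 := infDist_box_le_one i₀ L x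
    by_cases hx' : x ∈ box i₀ (L - 1)
    · rw [Set.indicator_of_mem hx', sub_self, add_zero]
      refine Real.rpow_le_rpow (by linarith) ?_ (by linarith)
      linarith [le_infDist_box i₀ hL0 hx']
    · rw [Set.indicator_of_notMem hx', sub_zero]
      have hd0 : 0 ≤ Metric.infDist x (box i₀ L)ᶜ := Metric.infDist_nonneg
      have : (1 - Metric.infDist x (box i₀ L)ᶜ) ^ q ≤ 1 :=
        Real.rpow_le_one (by linarith) (by linarith) (by linarith)
      have : 0 ≤ |x i₀| ^ q := by positivity
      linarith
  refine h1.trans (le_of_eq ?_)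
  rw [integral_add hi1 hi2, integral_sub (integrable_const _)
    ((integrable_const _).indicator hbox'.isOpen.measurableSet),
    integral_indicator hbox'.isOpen.measurableSet, Measure.restrict_restrict_of_subset hsub,
    integral_box i₀ hL0 fun t => |t| ^ q, integral_Ioo_abs_rpow (by linarith)]
  simp only [integral_const, measureReal_restrict_apply_univ, smul_eq_mul, mul_one]
  rw [volume_box i₀ hL0, volume_box i₀ (by linarith)]
  have e : (2 * (L - 1)) ^ (D - 1) = (2 * L) ^ (D - 1) * (1 - 1 / L) ^ (D - 1) := by
    rw [← mul_pow]
    congr 1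
    field_simp
  rw [e]
  ring

/-- The shape ratio of long boxes is asymptotically at most that of a slab. -/
theorem le_of_forall_le_shapeRatio_box (i₀ : Fin D) (hpq : p.HolderConjugate q) {c : ℝ}
    (hc0 : 0 ≤ c) (hc : ∀ L > (1 : ℝ), c ≤ shapeRatio p q (box i₀ L)) : c ≤ 1 / 2 * (q + 1) ^ (1 / q) := by
  have hD : D ≠ 0 := fun h => by subst h; exact i₀.elim0
  have hq := hpq.symm.lt
  have hp0 := hpq.pos
  set A : ℝ → ℝ := fun L => 1 / (q + 1) + 1 - (1 - 1 / L) ^ (D - 1) with hA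
  have key : ∀ L > (1 : ℝ), c * (1 - A L) ≤ 1 / 2 * q * A L ^ (1 / p) := by
    intro L hL
    have hL0 : 0 < L := by linarith
    have hbox := isConvexDomain_box i₀ hL0
    have hV := hbox.volume_pos
    have hfm := isFiniteMeasure_restrict hbox.isBounded
    have hC := hbox.torsionConst_pos hD hpq.lt
    set V := volume.real (box i₀ L) with hVdef
    set C := torsionConst p (box i₀ L) with hCdef
    have hA0 : 0 ≤ A L := by
      have : 1 / L ≤ 1 := (div_le_one hL0).2 hL.le
      have h2 : 0 < 1 / L := by positivity
      have h3 : (1 - 1 / L) ^ (D - 1) ≤ 1 := pow_le_one₀ (by linarith) (by linarith)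
      have h4 : 0 < 1 / (q + 1) := by positivity
      simp only [hA]
      linarith
    have h1 := hbox.integral_dist_le hD hpq (infDist_box_le_one i₀ L)
    have hI := integral_box_dist_le i₀ hL hq
    set I := ∫ x in box i₀ L, (1 - Metric.infDist x (box i₀ L)ᶜ) ^ q with hIdef
    have hI0 : 0 ≤ I := integral_nonneg fun x =>
      Real.rpow_nonneg (by linarith [infDist_box_le_one i₀ L x]) _
    have hi : IntegrableOn (fun x => (1 - Metric.infDist x (box i₀ L)ᶜ) ^ q) (box i₀ L) :=
      integrableOn_of_continuous hbox.isBounded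
        ((continuous_const.sub (Metric.continuous_infDist_pt _)).rpow_const
          fun _ => Or.inr (by linarith))
    rw [integral_div, integral_sub (integrable_const _) hi, integral_const,
      measureReal_restrict_apply_univ, smul_eq_mul, mul_one] at h1
    have h2 : I ^ (1 / p) ≤ V ^ (1 / p) * A L ^ (1 / p) := by
      rw [← Real.mul_rpow hV.le hA0]
      exact Real.rpow_le_rpow hI0 hI (by positivity)
    have h3 : V * (1 - A L) ≤ q * (C * (V ^ (1 / p) * A L ^ (1 / p))) := by
      have : V - I ≤ q * (C * I ^ (1 / p)) := by
        rw [div_le_iff₀ (by linarith)] at h1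
        linarith
      have h5 : q * (C * I ^ (1 / p)) ≤ q * (C * (V ^ (1 / p) * A L ^ (1 / p))) := by gcongr
      have h6 : V * (1 - A L) ≤ V - I := by linarith
      linarith
    have e : V ^ (1 / p) * V ^ (1 / q) = V := by
      rw [← Real.rpow_add hV, one_div, one_div, hpq.inv_add_inv_eq_one, Real.rpow_one]
    have hδ := avgDist_box_le i₀ hL0
    -- For `L` near `1` the factor may be non-positive and the claim is trivial; the positive case
    -- is the one that matters as `L → ∞`.
    by_cases hneg : 1 - A L ≤ 0
    · exact (mul_nonpos_of_nonneg_of_nonpos hc0 hneg).trans (by positivity)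
    · push Not at hneg
      have h4 : c * C ≤ 1 / 2 * V ^ (1 / q) := by
        have := hc L hL
        rw [shapeRatio, le_div_iff₀ hC] at this
        refine this.trans ?_
        gcongr
      have h7 : (c * (1 - A L)) * (C * V) ≤ (1 / 2 * q * A L ^ (1 / p)) * (C * V) := by
        calc (c * (1 - A L)) * (C * V) = (c * C) * (V * (1 - A L)) := by ring
          _ ≤ (1 / 2 * V ^ (1 / q)) * (V * (1 - A L)) := by gcongr
          _ ≤ (1 / 2 * V ^ (1 / q)) * (q * (C * (V ^ (1 / p) * A L ^ (1 / p)))) := by gcongr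
          _ = (1 / 2 * q * A L ^ (1 / p)) * (C * (V ^ (1 / p) * V ^ (1 / q))) := by ring
          _ = _ := by rw [e]
      exact le_of_mul_le_mul_right h7 (by positivity)
  have hAlim : Tendsto A atTop (𝓝 (1 / (q + 1))) := by
    have h1 : Tendsto (fun L : ℝ => 1 / L) atTop (𝓝 0) := tendsto_const_nhds.div_atTop tendsto_id
    have h2 := ((tendsto_const_nhds (x := 1 / (q + 1) + 1)).sub
      (((tendsto_const_nhds (x := (1 : ℝ))).sub h1).pow (D - 1)))
    simpa [hA] using h2
  have l1 := (tendsto_const_nhds (x := c)).mul ((tendsto_const_nhds (x := (1 : ℝ))).sub hAlim)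
  have l2 := (hAlim.rpow_const (p := 1 / p) (Or.inr (by positivity))).const_mul (1 / 2 * q)
  have hle := le_of_tendsto_of_tendsto l1 l2 ((eventually_gt_atTop 1).mono key)
  have e1 : 1 - 1 / (q + 1) = q / (q + 1) := by field_simp; ring
  rw [e1] at hle
  have e2 : (q + 1) * (1 / (q + 1)) ^ (1 / p) = (q + 1) ^ (1 / q) := by
    rw [one_div (q + 1), Real.inv_rpow (by positivity), ← Real.rpow_neg (by positivity)]
    nth_rewrite 1 [← Real.rpow_one (q + 1)]
    rw [← Real.rpow_add (by positivity)]
    congr 1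
    have := hpq.inv_add_inv_eq_one
    rw [one_div, one_div]
    linarith
  have h8 : c * q ≤ (1 / 2 * ((q + 1) * (1 / (q + 1)) ^ (1 / p))) * q := by
    have := mul_le_mul_of_nonneg_right hle (by positivity : 0 ≤ q + 1)
    have e3 : c * (q / (q + 1)) * (q + 1) = c * q := by field_simp
    rw [e3] at this
    linarith
  rw [e2] at h8
  exact le_of_mul_le_mul_right h8 (by positivity)

end Torsion

/-! ### From shape ratios to the families of fixed average distance. -/

namespace Torsion

variable {D : ℕ} {p q : ℝ} {Ω : Set (E D)}

theorem isConvexDomain_of_mem_convexDomains {r : ℝ} (hr : 0 < r) (h : Ω ∈ convexDomains D r) :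
    IsConvexDomain Ω := by
  obtain ⟨ho, hb, hc, hδ⟩ := h
  refine ⟨ho, hb, hc, Set.nonempty_iff_ne_empty.2 fun he => ?_⟩
  rw [he] at hδ
  simp [avgDist] at hδ
  exact hr.ne hδ

theorem normTorsion_of_mem_convexDomains (hD : D ≠ 0) (hpq : p.HolderConjugate q) {r : ℝ}
    (hr : 0 < r) (h : Ω ∈ convexDomains D r) :
    normTorsion p Ω = (shapeRatio p q Ω / r) ^ p := by
  have hδ : avgDist Ω = r := h.2.2.2
  rw [(isConvexDomain_of_mem_convexDomains hr h).normTorsion_eq_shapeRatio hD hpq (hδ ▸ hr), hδ]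

/-- Dilating by `r / δ(Ω)` keeps the shape ratio, so each family realizes exactly the same ratios.
-/
theorem IsConvexDomain.exists_mem_convexDomains (h : IsConvexDomain Ω) (hD : D ≠ 0)
    (hpq : p.HolderConjugate q) {r : ℝ} (hr : 0 < r) :
    ∃ Ω' ∈ convexDomains D r, shapeRatio p q Ω' = shapeRatio p q Ω := by
  have hδ := h.avgDist_pos hD
  have ht : 0 < r / avgDist Ω := div_pos hr hδ
  have h' := h.smul ht
  refine ⟨_, ⟨h'.isOpen, h'.isBounded, h'.convex, ?_⟩, h.shapeRatio_smul hD hpq ht⟩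
  rw [avgDist_smul ht, div_mul_cancel₀ _ hδ.ne']

/-- The shape ratio of a slab is smaller than that of a ball. -/
theorem slab_lt_ball (hD : 2 ≤ D) (hq : 1 < q) :
    1 / 2 * (q + 1) ^ (1 / q) < D / (D + 1) * ((D + q) / D) ^ (1 / q) := by
  have hD' : (2 : ℝ) ≤ D := by exact_mod_cast hD
  have hq0 : 0 < q := by linarith
  have hX : 0 < ((D + q) / D) ^ (1 / q) := by positivity
  have hDq : (0 : ℝ) < D + q := by positivity
  have e : (q + 1) ^ (1 / q) = (1 + q * (D - 1) / (D + q)) ^ (1 / q) * ((D + q) / D) ^ (1 / q) := by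
    rw [← Real.mul_rpow _ (by positivity)]
    · congr 1
      field_simp
      ring
    · have : 0 ≤ q * (D - 1) / (D + q) := div_nonneg (mul_nonneg hq0.le (by linarith)) hDq.le
      linarith
  have hs : 0 ≤ q * (D - 1) / (D + q) := div_nonneg (mul_nonneg hq0.le (by linarith)) hDq.le
  -- Bernoulli's inequality for the exponent `1/q ≤ 1`. The strict comparison that follows reduces
  -- to `(D - 1)(q - 1) > 0`.
  have hb : (1 + q * (D - 1) / (D + q)) ^ (1 / q) ≤ 1 + 1 / q * (q * (D - 1) / (D + q)) :=
    rpow_one_add_le_one_add_mul_self (by linarith) (by positivity)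
      ((div_le_one hq0).2 hq.le)
  have hb' : 1 + 1 / q * (q * (D - 1) / (D + q)) < 2 * D / (D + 1) := by
    have : 1 + 1 / q * (q * (D - 1) / (D + q)) = (2 * D - 1 + q) / (D + q) := by
      field_simp; ring
    rw [this, div_lt_div_iff₀ hDq (by positivity)]
    nlinarith
  rw [e, ← mul_assoc]
  refine mul_lt_mul_of_pos_right ?_ hX
  calc 1 / 2 * (1 + q * (D - 1) / (D + q)) ^ (1 / q) < 1 / 2 * (2 * D / (D + 1)) := by
        linarith
    _ = _ := by ring

end Torsion

/-! ### The threshold as the ratio of the extreme shape ratios. -/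

theorem mainTheorem3 (D : ℕ) (hD : 2 ≤ D) (p : ℝ) (hp : 1 < p) :
    ∃ γ : ℝ, γ ∈ Set.Ico (2 / ((D : ℝ) * ((D : ℝ) + 1))) 1 ∧
      ∀ a b : ℝ, 0 < a → a < b →
        ((∀ Ωa ∈ Torsion.convexDomains D a, ∀ Ωb ∈ Torsion.convexDomains D b,
            Torsion.normTorsion p Ωb ≤ Torsion.normTorsion p Ωa) ↔ γ * b ≥ a) ∧
        (γ * b > a →
          ∀ Ωa ∈ Torsion.convexDomains D a, ∀ Ωb ∈ Torsion.convexDomains D b,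
            Torsion.normTorsion p Ωb < Torsion.normTorsion p Ωa) ∧
        (γ * b = a →
          ∃ U V : ℕ → Set (Torsion.E D),
            (∀ n, U n ∈ Torsion.convexDomains D a) ∧
            (∀ n, V n ∈ Torsion.convexDomains D b) ∧
            ∃ l : ℝ,
              Tendsto (fun n => Torsion.normTorsion p (V n)) atTop (𝓝 l) ∧
              Tendsto (fun n => Torsion.normTorsion p (U n)) atTop (𝓝 l)) := by
  obtain ⟨q, hpq⟩ : ∃ q, p.HolderConjugate q := ⟨_, Real.HolderConjugate.conjExponent hp⟩
  have hD0 : D ≠ 0 := by omega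
  have hD2 : (2 : ℝ) ≤ D := by exact_mod_cast hD
  have hp0 : 0 < p := by positivity
  set S : Set ℝ := Torsion.shapeRatio p q '' {Ω : Set (Torsion.E D) | Torsion.IsConvexDomain Ω}
    with hS
  have hmemS : ∀ {Ω : Set (Torsion.E D)}, Torsion.IsConvexDomain Ω →
      Torsion.shapeRatio p q Ω ∈ S := fun h => ⟨_, h, rfl⟩
  have hSne : S.Nonempty := ⟨_, hmemS Torsion.isConvexDomain_ball⟩
  have hlow : ∀ s ∈ S, 1 / ((D : ℝ) + 1) ≤ s := by
    rintro _ ⟨Ω, hΩ, rfl⟩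
    exact Torsion.IsConvexDomain.one_div_le_shapeRatio hΩ hD0 hpq
  have hup : ∀ s ∈ S, s ≤ 1 := by
    rintro _ ⟨Ω, hΩ, rfl⟩
    exact Torsion.IsConvexDomain.shapeRatio_le_one hΩ hD0 hpq
  have hbb : BddBelow S := ⟨_, hlow⟩
  have hba : BddAbove S := ⟨_, hup⟩
  set m := sInf S with hm
  set M := sSup S with hM
  have hm1 : 1 / ((D : ℝ) + 1) ≤ m := le_csInf hSne hlow
  have hM1 : M ≤ 1 := csSup_le hSne hup
  have hm0 : 0 < m := lt_of_lt_of_le (by positivity) hm1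
  have hmM : m < M := by
    have h1 : m ≤ 1 / 2 * (q + 1) ^ (1 / q) :=
      Torsion.le_of_forall_le_shapeRatio_box (⟨0, by omega⟩ : Fin D) hpq hm0.le fun L hL =>
        csInf_le hbb (hmemS (Torsion.isConvexDomain_box _ (by linarith)))
    have h2 := (Torsion.le_shapeRatio_ball hD0 hpq).trans
      (le_csSup hba (hmemS Torsion.isConvexDomain_ball))
    exact h1.trans_lt ((Torsion.slab_lt_ball hD hpq.symm.lt).trans_le h2)
  have hM0 : 0 < M := hm0.trans hmM
  refine ⟨m / M, ⟨?_, (div_lt_one hM0).2 hmM⟩, fun a b ha hab => ?_⟩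
  -- The first inequality is `2 ≤ D`, the last is `M ≤ 1`.
  · calc 2 / ((D : ℝ) * (D + 1)) ≤ 1 / (D + 1) := by
          rw [div_le_div_iff₀ (by positivity) (by positivity)]
          nlinarith
      _ ≤ m := hm1
      _ ≤ m / M := by
          rw [le_div_iff₀ hM0]
          nlinarith
  have hb : 0 < b := ha.trans hab
  have hγ : ∀ {Ωa Ωb : Set (Torsion.E D)}, Ωa ∈ Torsion.convexDomains D a →
      Ωb ∈ Torsion.convexDomains D b →
      m ≤ Torsion.shapeRatio p q Ωa ∧ Torsion.shapeRatio p q Ωb ≤ M ∧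
        0 ≤ Torsion.shapeRatio p q Ωb := by
    intro Ωa Ωb h1 h2
    have h1' := hmemS (Torsion.isConvexDomain_of_mem_convexDomains ha h1)
    have h2' := hmemS (Torsion.isConvexDomain_of_mem_convexDomains hb h2)
    exact ⟨csInf_le hbb h1', le_csSup hba h2', le_trans (by positivity) (hlow _ h2')⟩
  refine ⟨⟨fun h => ?_, fun h Ωa h1 Ωb h2 => ?_⟩, fun h Ωa h1 Ωb h2 => ?_, fun h => ?_⟩
  -- Any two shapes can be placed in the two families independently, so the hypothesis compares
  -- every pair of ratios; taking the supremum and the infimum gives `M a ≤ m b`.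
  · have key : ∀ s ∈ S, ∀ t ∈ S, s * a ≤ t * b := by
      rintro _ ⟨Ω, hΩ, rfl⟩ _ ⟨Ω', hΩ', rfl⟩
      have hΩ1 : Torsion.IsConvexDomain Ω := hΩ
      have hΩ2 : Torsion.IsConvexDomain Ω' := hΩ'
      obtain ⟨Ωb, hb1, hb2⟩ := hΩ1.exists_mem_convexDomains hD0 hpq hb
      obtain ⟨Ωa, ha1, ha2⟩ := hΩ2.exists_mem_convexDomains hD0 hpq ha
      have h3 := h Ωa ha1 Ωb hb1
      rw [Torsion.normTorsion_of_mem_convexDomains hD0 hpq ha ha1,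
        Torsion.normTorsion_of_mem_convexDomains hD0 hpq hb hb1, ha2, hb2] at h3
      have p1 : 0 < Torsion.shapeRatio p q Ω := lt_of_lt_of_le (by positivity) (hlow _ (hmemS hΩ1))
      have p2 : 0 < Torsion.shapeRatio p q Ω' := lt_of_lt_of_le (by positivity) (hlow _ (hmemS hΩ2))
      rw [Real.rpow_le_rpow_iff (by positivity) (by positivity) hp0,
        div_le_div_iff₀ hb ha] at h3
      exact h3
    have h1 : M * a ≤ m * b := by
      rw [← div_le_iff₀ hb]
      refine le_csInf hSne fun t ht => ?_
      rw [div_le_iff₀ hb, ← le_div_iff₀ ha]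
      exact csSup_le hSne fun s hs => (le_div_iff₀ ha).2 (key s hs t ht)
    rw [ge_iff_le, div_mul_eq_mul_div, le_div_iff₀ hM0]
    linarith
  · obtain ⟨h3, h4, h5⟩ := hγ h1 h2
    rw [Torsion.normTorsion_of_mem_convexDomains hD0 hpq ha h1,
      Torsion.normTorsion_of_mem_convexDomains hD0 hpq hb h2]
    refine Real.rpow_le_rpow (by positivity) ?_ hp0.le
    rw [ge_iff_le, div_mul_eq_mul_div, le_div_iff₀ hM0] at h
    calc Torsion.shapeRatio p q Ωb / b ≤ M / b := by gcongr
      _ ≤ m / a := by rw [div_le_div_iff₀ hb ha]; linarith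
      _ ≤ _ := by gcongr
  · obtain ⟨h3, h4, h5⟩ := hγ h1 h2
    rw [Torsion.normTorsion_of_mem_convexDomains hD0 hpq ha h1,
      Torsion.normTorsion_of_mem_convexDomains hD0 hpq hb h2]
    refine Real.rpow_lt_rpow (by positivity) ?_ hp0
    rw [gt_iff_lt, div_mul_eq_mul_div, lt_div_iff₀ hM0] at h
    calc Torsion.shapeRatio p q Ωb / b ≤ M / b := by gcongr
      _ < m / a := by rw [div_lt_div_iff₀ hb ha]; linarith
      _ ≤ _ := by gcongr
  · have hseq : ∀ {r : ℝ}, 0 < r → ∀ {s : ℕ → ℝ} {x : ℝ}, Tendsto s atTop (𝓝 x) → (∀ n, s n ∈ S) →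
        ∃ W : ℕ → Set (Torsion.E D), (∀ n, W n ∈ Torsion.convexDomains D r) ∧
          Tendsto (fun n => Torsion.normTorsion p (W n)) atTop (𝓝 ((x / r) ^ p)) := by
      intro r hr s x hs hsS
      have hex : ∀ n, ∃ Ω ∈ Torsion.convexDomains D r, Torsion.shapeRatio p q Ω = s n := by
        intro n
        obtain ⟨Ω, hΩ, hΩs⟩ := hsS n
        have hΩ1 : Torsion.IsConvexDomain Ω := hΩ
        obtain ⟨Ω', h1, h2⟩ := hΩ1.exists_mem_convexDomains hD0 hpq hr
        exact ⟨Ω', h1, h2.trans hΩs⟩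
      choose W hW hWs using hex
      refine ⟨W, hW, ?_⟩
      have : ∀ n, Torsion.normTorsion p (W n) = (s n / r) ^ p := fun n => by
        rw [Torsion.normTorsion_of_mem_convexDomains hD0 hpq hr (hW n), hWs]
      simp only [this]
      exact (hs.div_const r).rpow_const (Or.inr hp0.le)
    obtain ⟨s, -, hs, hsS⟩ := exists_seq_tendsto_sInf hSne hbb
    obtain ⟨t, -, ht, htS⟩ := exists_seq_tendsto_sSup hSne hba
    obtain ⟨U, hU, hUl⟩ := hseq ha hs hsS
    obtain ⟨V, hV, hVl⟩ := hseq hb ht htS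
    -- `V` approaches the largest ratio and `U` the smallest; at the threshold `M / b = m / a`.
    refine ⟨U, V, hU, hV, (M / b) ^ p, hVl, ?_⟩
    have e : M / b = m / a := by
      rw [div_mul_eq_mul_div, div_eq_iff hM0.ne'] at h
      rw [div_eq_div_iff hb.ne' ha.ne']
      linarith
    rw [e]
    exact hUl
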